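/- **Proposition 3.** Let $T>0$, $S_0>0$, $r\in\mathbb R$, $0<\sigma_1\le s$, $\mu_1<\mu_2$, and let $S_T:\Omega\to[0,\infty)$, where $\Omega$ carries the $\sigma$-algebra generated by $S_T$. Let $\mathbb Q$ be a probability measure under which $S_T$ is log-normal with parameters $\log S_0+(r-\tfrac{s^2}{2})T$ and $s^2T$, and for $(\mu,\sigma)\in\mathcal D:=[\mu_1,\mu_2]\times[\sigma_1,s]$ let $\mathbb P^{\mu,\sigma}$ be a probability measure under which $S_T$ is log-normal with parameters $\log S_0+(\mu-\tfrac{\sigma^2}{2})T$ and $\sigma^2T$; put $\mathcal P=\{\mathbb P^{\mu,\sigma}:(\mu,\sigma)\in\mathcal D\}$. Write $F_X^{\mathbb P}$ for the distribution function of $X$ under $\mathbb P$, and $\ell^{\mathbb P}=d\mathbb P/d\mathbb Q$. Let $\mathbb F_{SSD}$ be the set of nondecreasing concave functions $f:[0,\infty)\to\mathbb R$; for distribution functions $F,G$ of laws on $[0,\infty)$ write $F\preceq_{SSD}G$ if $\int f\,dF\le\int f\,dG$ for every $f\in\mathbb F_{SSD}$ for which both integrals are finite. A measure $\mathbb P'\in\mathcal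 P$ is *least favorable* (for $\mathbb F_{SSD}$) if $F^{\mathbb P'}_{\ell^{\mathbb P'}}\preceq_{SSD}F^{\mathbb P}_{\ell^{\mathbb P'}}$ for all $\mathbb P\in\mathcal P$. A *payoff* is a random variable $X=g(S_T)$ with $g:[0,\infty)\to[0,\infty)$ measurable and $E_{\mathbb Q}[X]<\infty$; its price is $e^{-rT}E_{\mathbb Q}[X]$. An *$\mathbb F_{SSD}$-robust cost-efficient payoff* for a distribution function $F_0$ is a payoff of minimal price among all payoffs $X$ with $F_0\preceq_{SSD}F_X^{\mathbb P}$ for all $\mathbb P\in\mathcal P$. Let $F_0^{-1}(p)=\inf\{x\ge 0: F_0(x)\ge p\}$. Suppose $\frac{\mu_1-r}{s^2}\in(0,1]$. Then: 1. $F_{S_T}^{\mathbb P^{\mu_1,s}}\preceq_{SSD}F_{S_T}^{\mathbb P^{\mu,\sigma}}$ for all $(\mu,\sigma)\in\mathcal D$. 2. $\mathbb P^*:=\mathbb P^{\mu_1,s}$ is the (unique) least favorable measure in $\mathcal P$ for $\mathbb F_{SSD}$. With $\ell^*:=\ell^{\mathbb P^*}$, the function $F_{\ell^*}^{\mathbb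 P^*}$ is continuous and $1/\ell^*$ has finite variance under $\mathbb P^*$. 3. If $F_0$ is a distribution function with $F_0(x)=0$ for $x<0$ and $\int_0^1(F_0^{-1}(u))^2\,du<\infty$, and if $F_0^{-1}\circ F_{\ell^*}^{\mathbb P^*}$ is concave on $[0,\infty)$, then $$X^*:=F_0^{-1}\bigl(F_{S_T}^{\mathbb P^{\mu_1,s}}(S_T)\bigr)$$ is an $\mathbb F_{SSD}$-robust cost-efficient payoff for $F_0$, and every other one equals $X^*$ $\mathbb P^*$-almost surely. -/

import Mathlib

open MeasureTheory ProbabilityTheory Set Filter Topology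

noncomputable section

namespace RobustCost

/-- A (cumulative) distribution function on `ℝ`: nondecreasing and right-continuous
(a `StieltjesFunction`), with limits `0` at `-∞` and `1` at `+∞`. -/
def IsDistributionFunction (F : StieltjesFunction ℝ) : Prop :=
  Tendsto F atBot (𝓝 0) ∧ Tendsto F atTop (𝓝 1)

/-- The generalized inverse of a distribution function carried by `[0, ∞)`:
`F⁻¹(p) = inf {x ≥ 0 : F x ≥ p}`; in particular `F⁻¹(0) = 0`. -/
def quantile (F : StieltjesFunction ℝ) (p : ℝ) : ℝ :=
  sInf {x : ℝ | 0 ≤ x ∧ p ≤ F x}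

/-- The integral stochastic order on distribution functions carried by `[0, ∞)`, with respect to
a set `𝔽` of functions on `[0, ∞)` (only the values on `[0, ∞)` matter): `G` dominates `F`. -/
def IntegralOrder (𝔽 : Set (ℝ → ℝ)) (F G : StieltjesFunction ℝ) : Prop :=
  ∀ f ∈ 𝔽, IntegrableOn f (Ici 0) F.measure → IntegrableOn f (Ici 0) G.measure →
    ∫ x in Ici 0, f x ∂F.measure ≤ ∫ x in Ici 0, f x ∂G.measure

/-- The nondecreasing concave functions on `[0, ∞)` (second order stochastic dominance). -/
def SSD : Set (ℝ → ℝ) :=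
  {f | MonotoneOn f (Ici 0) ∧ ConcaveOn ℝ (Ici 0) f}

/-- The log-normal law with parameters `M` and `V`: the law of `exp Z`, `Z ∼ N(M, V)`. -/
def logNormal (M V : ℝ) : Measure ℝ :=
  (gaussianReal M V.toNNReal).map Real.exp

/-- The law of the asset price at time `T` with drift `m` and volatility `ς`: log-normal with
parameters `log S₀ + (m - ς² / 2) T` and `ς² T`. -/
def priceLaw (S₀ T m ς : ℝ) : Measure ℝ :=
  logNormal (Real.log S₀ + (m - ς ^ 2 / 2) * T) (ς ^ 2 * T)

variable {Ω : Type*} [MeasurableSpace Ω]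

/-- The distribution function of the random variable `X` under `P`. -/
def distFun (P : Measure Ω) (X : Ω → ℝ) : StieltjesFunction ℝ :=
  cdf (P.map X)

/-- The likelihood ratio `dP/dQ`. -/
def likelihoodRatio (P Q : Measure Ω) (ω : Ω) : ℝ :=
  (P.rnDeriv Q ω).toReal

/-- The payoffs `g(S)`, with `g : [0, ∞) → [0, ∞)` measurable and `E_Q |g(S)| < ∞`. -/
def payoffs (S : Ω → ℝ) (Q : Measure Ω) : Set (Ω → ℝ) :=
  {X | ∃ g : ℝ → ℝ, Measurable g ∧ (∀ x, 0 ≤ x → 0 ≤ g x) ∧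
    (X = fun ω => g (S ω)) ∧ Integrable X Q}

/-- The price `e^{-rT} E_Q[X]`. -/
def price (r T : ℝ) (Q : Measure Ω) (X : Ω → ℝ) : ℝ :=
  Real.exp (-(r * T)) * ∫ ω, X ω ∂Q

/-- The payoffs whose distribution function under every `P ∈ Pset` dominates `F₀`. -/
def admissible (𝔽 : Set (ℝ → ℝ)) (Pset : Set (Measure Ω)) (S : Ω → ℝ) (Q : Measure Ω)
    (F₀ : StieltjesFunction ℝ) : Set (Ω → ℝ) :=
  {X | X ∈ payoffs S Q ∧ ∀ P ∈ Pset, IntegralOrder 𝔽 F₀ (distFun P X)}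

/-- `X` is a solution of the `𝔽`-robust cost-efficiency problem for `F₀`: an admissible payoff
of minimal price. -/
def IsRobustCostEfficient (𝔽 : Set (ℝ → ℝ)) (Pset : Set (Measure Ω)) (S : Ω → ℝ) (Q : Measure Ω)
    (r T : ℝ) (F₀ : StieltjesFunction ℝ) (X : Ω → ℝ) : Prop :=
  X ∈ admissible 𝔽 Pset S Q F₀ ∧ ∀ Y ∈ admissible 𝔽 Pset S Q F₀, price r T Q X ≤ price r T Q Y

/-- `P'` is a least favorable measure in `Pset` with respect to `𝔽`. -/
def IsLeastFavorable (𝔽 : Set (ℝ → ℝ)) (Pset : Set (Measure Ω)) (Q P' : Measure Ω) : Prop :=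
  P' ∈ Pset ∧ ∀ P ∈ Pset,
    IntegralOrder 𝔽 (distFun P' (likelihoodRatio P' Q)) (distFun P (likelihoodRatio P' Q))

/-- The set of measures `P^{μ,σ}` with `μ₁ ≤ μ ≤ μ₂` and `σ₁ ≤ σ ≤ s`. -/
def plausible (P : ℝ → ℝ → Measure Ω) (μ₁ μ₂ σ₁ s : ℝ) : Set (Measure Ω) :=
  {R | ∃ μ ∈ Icc μ₁ μ₂, ∃ σ ∈ Icc σ₁ s, R = P μ σ}

end RobustCost

end

namespace RobustCost

/-! Under `Q` and `P μ₁ s` the variable `log S` is Gaussian with the same variance, so the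
likelihood ratio `ℓ` is a.s. a constant times `S ^ κ`, `κ = (μ₁ - r) / s ^ 2`. As `κ ∈ (0, 1]`, this
is a nondecreasing concave function of `S`, and comparisons of `S` pass to `ℓ`. The comparison of
`S` is Jensen's inequality: the log-normal law with larger log-variance and smaller mean is the
other one times independent noise of mean at most one (`integral_exp_gaussianReal_le`).

Uniqueness comes from testing with the logarithm. Explicit Gaussian moments turn the inequality into
a sum of nonnegative terms being at most zero (`eq_of_integralOrder_likelihoodRatio`).

The candidate payoff is a.s. `φ(ℓ)` with `φ` nondecreasing and concave, and it has distribution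
function `F₀` under `P μ₁ s`; least favorability, applied to `f ∘ φ`, makes it admissible. For
optimality, a price is an integral under `P μ₁ s` against `1 / ℓ`, a decreasing exponential of `log
S`, hence a positive mixture over `b` of the partial integrals over `log S < b`
(`lintegral_mul_exp_neg`). The test functions `min x k` bound these below by those of the candidate
(`setLIntegral_Iio_le_of_integral_min_le`). Equal prices force all partial integrals, and so the
payoffs, to agree (`ae_eq_of_lintegral_mul_exp_neg_le`). -/

/-! ### Nondecreasing concave test functions and the order they induce. -/

lemma aestronglyMeasurable_of_mem_SSD {f : ℝ → ℝ} (hf : f ∈ SSD) {ν : Measure ℝ}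
    (hν : ∀ᵐ x ∂ν, 0 ≤ x) : AEStronglyMeasurable f ν := by
  have h := aemeasurable_restrict_of_monotoneOn (μ := ν) measurableSet_Ici hf.1
  rw [Measure.restrict_eq_self_of_ae_mem (s := Ici (0 : ℝ)) hν] at h
  exact h.aestronglyMeasurable

lemma comp_mem_SSD {f φ : ℝ → ℝ} (hf : f ∈ SSD) (hφ : φ ∈ SSD) (h0 : ∀ x, 0 ≤ x → 0 ≤ φ x) :
    (fun x => f (φ x)) ∈ SSD := by
  have hmaps : MapsTo φ (Ici 0) (Ici 0) := fun x hx => h0 x hx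
  refine ⟨hf.1.comp hφ.1 hmaps, convex_Ici 0, ?_⟩
  intro x hx y hy a b ha hb hab
  have hxy : a • x + b • y ∈ Ici (0 : ℝ) := convex_Ici 0 hx hy ha hb hab
  refine (hf.2.2 (hmaps hx) (hmaps hy) ha hb hab).trans ?_
  exact hf.1 (convex_Ici 0 (hmaps hx) (hmaps hy) ha hb hab) (hmaps hxy)
    (hφ.2.2 hx hy ha hb hab)

/-- For `k ≥ 0` these are bounded on `[0, ∞)`, so testing with them needs no integrability of the
payoff under `P`. -/
lemma min_const_mem_SSD (k : ℝ) : (fun x => min x k) ∈ SSD := by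
  refine ⟨fun x _ y _ h => min_le_min_right k h, ?_⟩
  exact (concaveOn_id (convex_Ici (0 : ℝ))).inf (concaveOn_const k (convex_Ici 0))

/-- The shift keeps the logarithm finite and monotone up to the endpoint `0`; it is removed later by
letting `ε → 0`. -/
lemma log_add_mem_SSD {ε : ℝ} (hε : 0 < ε) : (fun x => Real.log (ε + x)) ∈ SSD := by
  refine ⟨fun x hx y _ h => Real.log_le_log (by simp at hx; linarith) (by linarith),
    convex_Ici 0, ?_⟩
  intro x hx y hy a b ha hb hab
  simp only [mem_Ici] at hx hy
  have := strictConcaveOn_log_Ioi.concaveOn.2 (x := ε + x) (by simp; linarith) (y := ε + y)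
    (by simp; linarith) ha hb hab
  refine this.trans_eq ?_
  congr 1
  simp only [smul_eq_mul]
  linear_combination ε * hab

lemma rpow_mem_SSD {c κ : ℝ} (hc : 0 ≤ c) (h0 : 0 ≤ κ) (h1 : κ ≤ 1) :
    (fun x : ℝ => c * x ^ κ) ∈ SSD := by
  refine ⟨fun x hx y _ h => mul_le_mul_of_nonneg_left (Real.rpow_le_rpow hx h h0) hc, ?_⟩
  exact (Real.concaveOn_rpow h0 h1).smul hc

/-- A nondecreasing concave function on `[0, ∞)` lies below a nondecreasing affine function
touching it at a given positive point. -/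
lemma exists_supergradient {f : ℝ → ℝ} (hf : f ∈ SSD) {a : ℝ} (ha : 0 < a) :
    ∃ k, 0 ≤ k ∧ ∀ x, 0 ≤ x → f x ≤ f a + k * (x - a) := by
  -- The slope is the infimum of the chord slopes to the left of `a`, that is, the left derivative;
  -- `0 < a` makes this set nonempty.
  set K : Set ℝ := (fun y => (f a - f y) / (a - y)) '' Ico 0 a with hK
  have hlow : ∀ z ∈ K, 0 ≤ z := by
    rintro z ⟨y, hy, rfl⟩
    exact div_nonneg (sub_nonneg.2 (hf.1 hy.1 ha.le hy.2.le)) (sub_nonneg.2 hy.2.le)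
  have hne : K.Nonempty := ⟨_, 0, ⟨le_rfl, ha⟩, rfl⟩
  refine ⟨sInf K, le_csInf hne hlow, fun x hx => ?_⟩
  rcases lt_trichotomy x a with h | rfl | h
  · have h1 : sInf K ≤ (f a - f x) / (a - x) := csInf_le ⟨0, hlow⟩ ⟨x, ⟨hx, h⟩, rfl⟩
    rw [le_div_iff₀ (sub_pos.2 h)] at h1
    linarith
  · simp
  · have h1 : (f x - f a) / (x - a) ≤ sInf K := by
      refine le_csInf hne ?_
      rintro z ⟨y, hy, rfl⟩
      exact hf.2.slope_anti_adjacent hy.1 hx hy.2 h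
    rw [div_le_iff₀ (sub_pos.2 h)] at h1
    linarith

section

variable {Ω Ω' : Type*} [MeasurableSpace Ω] [MeasurableSpace Ω']

lemma measure_distFun (P : Measure Ω) [IsProbabilityMeasure P] {X : Ω → ℝ}
    (hX : AEMeasurable X P) : (distFun P X).measure = P.map X := by
  have := Measure.isProbabilityMeasure_map hX
  exact measure_cdf _

lemma ae_nonneg_map {P : Measure Ω} {X : Ω → ℝ} (hX : AEMeasurable X P)
    (h0 : ∀ᵐ ω ∂P, 0 ≤ X ω) : ∀ᵐ x ∂(P.map X), 0 ≤ x :=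
  (ae_map_iff hX measurableSet_Ici).2 h0

lemma integrableOn_distFun_iff {P : Measure Ω} [IsProbabilityMeasure P] {X : Ω → ℝ}
    (hX : AEMeasurable X P) (h0 : ∀ᵐ ω ∂P, 0 ≤ X ω) {f : ℝ → ℝ} (hf : f ∈ SSD) :
    IntegrableOn f (Ici 0) (distFun P X).measure ↔ Integrable (fun ω => f (X ω)) P := by
  have h := ae_nonneg_map hX h0
  rw [measure_distFun P hX, IntegrableOn, Measure.restrict_eq_self_of_ae_mem (s := Ici (0 : ℝ)) h,
    integrable_map_measure (aestronglyMeasurable_of_mem_SSD hf h) hX]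
  rfl

lemma setIntegral_distFun {P : Measure Ω} [IsProbabilityMeasure P] {X : Ω → ℝ}
    (hX : AEMeasurable X P) (h0 : ∀ᵐ ω ∂P, 0 ≤ X ω) {f : ℝ → ℝ} (hf : f ∈ SSD) :
    ∫ x in Ici 0, f x ∂(distFun P X).measure = ∫ ω, f (X ω) ∂P := by
  have h := ae_nonneg_map hX h0
  rw [measure_distFun P hX, Measure.restrict_eq_self_of_ae_mem (s := Ici (0 : ℝ)) h,
    integral_map hX (aestronglyMeasurable_of_mem_SSD hf h)]

lemma integralOrder_distFun_iff {P : Measure Ω} {P' : Measure Ω'} [IsProbabilityMeasure P]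
    [IsProbabilityMeasure P'] {X : Ω → ℝ} {X' : Ω' → ℝ} (hX : AEMeasurable X P)
    (h0 : ∀ᵐ ω ∂P, 0 ≤ X ω) (hX' : AEMeasurable X' P') (h0' : ∀ᵐ ω ∂P', 0 ≤ X' ω) :
    IntegralOrder SSD (distFun P X) (distFun P' X') ↔
      ∀ f ∈ SSD, Integrable (fun ω => f (X ω)) P → Integrable (fun ω => f (X' ω)) P' →
        ∫ ω, f (X ω) ∂P ≤ ∫ ω, f (X' ω) ∂P' := by
  refine forall₂_congr fun f hf => ?_
  rw [integrableOn_distFun_iff hX h0 hf, integrableOn_distFun_iff hX' h0' hf,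
    setIntegral_distFun hX h0 hf, setIntegral_distFun hX' h0' hf]

end

/-! ### Second order comparison of log-normal laws. -/

open scoped NNReal in
/-- Second order comparison of log-normal laws: a larger log-variance together with a smaller
mean is dominated. -/
lemma integral_exp_gaussianReal_le {M M' : ℝ} {V V' : ℝ≥0} (hV : V' ≤ V)
    (hM : M + V / 2 ≤ M' + V' / 2) {f : ℝ → ℝ} (hf : f ∈ SSD)
    (hi : Integrable (fun y => f (Real.exp y)) (gaussianReal M V))
    (hi' : Integrable (fun y => f (Real.exp y)) (gaussianReal M' V')) :
    ∫ y, f (Real.exp y) ∂(gaussianReal M V) ≤ ∫ y, f (Real.exp y) ∂(gaussianReal M' V') := by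
  -- The wider Gaussian is the narrower one plus independent noise `ν`; `hM` says exactly that `exp`
  -- of the noise has mean at most one.
  have hconv : gaussianReal M V = gaussianReal M' V' ∗ gaussianReal (M - M') (V - V') := by
    rw [gaussianReal_conv_gaussianReal, add_tsub_cancel_of_le hV]
    congr 1; ring
  set ν := gaussianReal (M - M') (V - V')
  have hexp : Integrable Real.exp ν := by
    simpa using integrable_exp_mul_gaussianReal (μ := M - M') (v := V - V') 1
  have hmean : ∫ y, Real.exp y ∂ν ≤ 1 := by
    have := congrFun (mgf_id_gaussianReal (μ := M - M') (v := V - V')) 1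
    simp only [mgf, id, one_mul, mul_one, one_pow] at this
    rw [this, Real.exp_le_one_iff, NNReal.coe_sub hV]
    linarith
  rw [hconv] at hi ⊢
  have hprod : Integrable (fun p : ℝ × ℝ => f (Real.exp (p.1 + p.2)))
      ((gaussianReal M' V').prod ν) :=
    (integrable_map_measure hi.1 (by fun_prop)).1 hi
  rw [integral_conv hi]
  refine integral_mono_ae hprod.integral_prod_left hi' ?_
  filter_upwards [hprod.prod_right_ae] with x hx
  -- Jensen conditionally on `x`: the affine majorant at `exp x` is nondecreasing, so a noise mean
  -- below one only helps.
  obtain ⟨k, hk, hkf⟩ := exists_supergradient hf (Real.exp_pos x)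
  have hlin : Integrable (fun y => k * (Real.exp x * Real.exp y - Real.exp x)) ν :=
    ((hexp.const_mul _).sub (integrable_const _)).const_mul _
  calc ∫ y, f (Real.exp (x + y)) ∂ν
      ≤ ∫ y, (f (Real.exp x) + k * (Real.exp x * Real.exp y - Real.exp x)) ∂ν := by
        refine integral_mono hx ((integrable_const _).add hlin) fun y => ?_
        rw [← Real.exp_add]
        exact hkf _ (Real.exp_pos _).le
    _ = f (Real.exp x) + k * (Real.exp x * ∫ y, Real.exp y ∂ν - Real.exp x) := by
        rw [integral_add (integrable_const _) hlin, integral_const_mul,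
          integral_sub (hexp.const_mul _) (integrable_const _), integral_const_mul]
        simp
    _ ≤ f (Real.exp x) := by
        have : Real.exp x * ∫ y, Real.exp y ∂ν - Real.exp x ≤ 0 := by
          nlinarith [Real.exp_pos x]
        nlinarith

/-! ### Densities between the laws of `S`. -/

section

variable {Ω E : Type*} [mΩ : MeasurableSpace Ω] [MeasurableSpace E]

lemma map_withDensity_comp (μ : Measure Ω) {X : Ω → E} (hX : Measurable X) {f : E → ENNReal}
    (hf : Measurable f) :
    (μ.withDensity fun ω => f (X ω)).map X = (μ.map X).withDensity f := by
  ext B hB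
  rw [Measure.map_apply hX hB, withDensity_apply _ (hX hB), withDensity_apply _ hB,
    setLIntegral_map hB hf hX]

lemma ext_of_map_of_eq_comap {S : Ω → E} (hgen : mΩ = MeasurableSpace.comap S inferInstance)
    {P Q : Measure Ω} (h : P.map S = Q.map S) : P = Q := by
  have hS : Measurable S := by rw [measurable_iff_comap_le]; exact hgen.ge
  ext t ht
  obtain ⟨B, hB, rfl⟩ : ∃ B, MeasurableSet B ∧ S ⁻¹' B = t := by
    have : MeasurableSet[MeasurableSpace.comap S inferInstance] t := hgen ▸ ht
    exact this
  rw [← Measure.map_apply hS hB, h, Measure.map_apply hS hB]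

end

/-- The density of `N(M, V)` with respect to `N(M₀, V₀)`. -/
noncomputable def gaussianRatio (M : ℝ) (V : NNReal) (M₀ : ℝ) (V₀ : NNReal) (y : ℝ) : ℝ :=
  gaussianPDFReal M V y / gaussianPDFReal M₀ V₀ y

section

variable {M M₀ : ℝ} {V V₀ : NNReal}

lemma measurable_gaussianRatio : Measurable (gaussianRatio M V M₀ V₀) :=
  (measurable_gaussianPDFReal _ _).div (measurable_gaussianPDFReal _ _)

lemma gaussianRatio_pos (hV : V ≠ 0) (hV₀ : V₀ ≠ 0) (y : ℝ) : 0 < gaussianRatio M V M₀ V₀ y :=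
  div_pos (gaussianPDFReal_pos _ _ _ hV) (gaussianPDFReal_pos _ _ _ hV₀)

lemma gaussianReal_eq_withDensity_gaussianRatio (hV : V ≠ 0) (hV₀ : V₀ ≠ 0) :
    gaussianReal M V = (gaussianReal M₀ V₀).withDensity
      fun y => ENNReal.ofReal (gaussianRatio M V M₀ V₀ y) := by
  rw [gaussianReal_of_var_ne_zero _ hV, gaussianReal_of_var_ne_zero _ hV₀,
    ← withDensity_mul _ (measurable_gaussianPDF _ _) measurable_gaussianRatio.ennreal_ofReal]
  congr 1
  ext y
  have h0 := gaussianPDFReal_pos M₀ V₀ y hV₀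
  rw [Pi.mul_apply, gaussianPDF, gaussianPDF, ← ENNReal.ofReal_mul h0.le, gaussianRatio,
    mul_div_cancel₀ _ h0.ne']

/-- The log-likelihood ratio of two Gaussian laws is quadratic. -/
lemma exists_gaussianRatio_eq_exp (M M₀ : ℝ) (hV : V ≠ 0) (hV₀ : V₀ ≠ 0) :
    ∃ C, ∀ y, gaussianRatio M V M₀ V₀ y =
      Real.exp (C - (y - M) ^ 2 / (2 * V) + (y - M₀) ^ 2 / (2 * V₀)) := by
  have hp : ∀ v : NNReal, v ≠ 0 → 0 < (Real.sqrt (2 * Real.pi * v))⁻¹ := fun v hv => by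
    have : 0 < (v : ℝ) := by positivity
    positivity
  have hc := div_pos (hp V hV) (hp V₀ hV₀)
  refine ⟨Real.log ((Real.sqrt (2 * Real.pi * V))⁻¹ / (Real.sqrt (2 * Real.pi * V₀))⁻¹),
    fun y => ?_⟩
  rw [gaussianRatio, gaussianPDFReal, gaussianPDFReal, mul_div_mul_comm, ← Real.exp_sub,
    add_comm_sub, Real.exp_add, Real.exp_log hc]
  congr 2
  ring

/-- For equal variances the log-likelihood ratio is affine. -/
lemma exists_gaussianRatio_eq_exp_affine (M M₀ : ℝ) (hV : V ≠ 0) :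
    ∃ C, ∀ y, gaussianRatio M V M₀ V y = Real.exp ((M - M₀) / V * y + C) := by
  obtain ⟨C, hC⟩ := exists_gaussianRatio_eq_exp M M₀ hV hV
  refine ⟨C - M ^ 2 / (2 * V) + M₀ ^ 2 / (2 * V), fun y => ?_⟩
  have : (V : ℝ) ≠ 0 := by exact_mod_cast hV
  rw [hC y]
  congr 1
  field_simp
  ring

end

section

variable {Ω : Type*} [mΩ : MeasurableSpace Ω] {S : Ω → ℝ} {P Q : Measure Ω} {M V M₀ V₀ : ℝ}

lemma ae_pos_of_map_eq_logNormal (hS : Measurable S) (hP : P.map S = logNormal M V) :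
    ∀ᵐ ω ∂P, 0 < S ω := by
  have h : ∀ᵐ x ∂(P.map S), 0 < x := by
    rw [hP, logNormal, ae_map_iff (by fun_prop) measurableSet_Ioi]
    exact ae_of_all _ Real.exp_pos
  exact ae_of_ae_map hS.aemeasurable h

lemma map_log_of_map_eq_logNormal (hS : Measurable S) (hP : P.map S = logNormal M V) :
    P.map (fun ω => Real.log (S ω)) = gaussianReal M V.toNNReal := by
  have h := congrArg (Measure.map Real.log) hP
  rw [Measure.map_map Real.measurable_log hS, logNormal,
    Measure.map_map Real.measurable_log Real.measurable_exp] at h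
  refine h.trans ?_
  have : Real.log ∘ Real.exp = id := funext Real.log_exp
  rw [this, Measure.map_id]

lemma eq_withDensity_of_map_eq_logNormal (hgen : mΩ = MeasurableSpace.comap S inferInstance)
    (hP : P.map S = logNormal M V) (hQ : Q.map S = logNormal M₀ V₀) (hV : 0 < V) (hV₀ : 0 < V₀) :
    P = Q.withDensity fun ω => ENNReal.ofReal
      (gaussianRatio M V.toNNReal M₀ V₀.toNNReal (Real.log (S ω))) := by
  have hS : Measurable S := by rw [measurable_iff_comap_le]; exact hgen.ge
  have hR := (measurable_gaussianRatio (M := M) (V := V.toNNReal) (M₀ := M₀)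
    (V₀ := V₀.toNNReal)).ennreal_ofReal
  have hRl : Measurable fun x =>
      ENNReal.ofReal (gaussianRatio M V.toNNReal M₀ V₀.toNNReal (Real.log x)) :=
    hR.comp Real.measurable_log
  refine ext_of_map_of_eq_comap hgen ?_
  rw [map_withDensity_comp Q hS hRl, hP, hQ, logNormal, logNormal,
    ← map_withDensity_comp _ Real.measurable_exp hRl]
  simp only [Real.log_exp]
  rw [← gaussianReal_eq_withDensity_gaussianRatio] <;> simpa

lemma absolutelyContinuous_of_map_eq_logNormal
    (hgen : mΩ = MeasurableSpace.comap S inferInstance)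
    (hP : P.map S = logNormal M V) (hQ : Q.map S = logNormal M₀ V₀) (hV : 0 < V) (hV₀ : 0 < V₀) :
    P ≪ Q := by
  rw [eq_withDensity_of_map_eq_logNormal hgen hP hQ hV hV₀]
  exact withDensity_absolutelyContinuous _ _

lemma likelihoodRatio_ae_eq [IsProbabilityMeasure Q]
    (hgen : mΩ = MeasurableSpace.comap S inferInstance)
    (hP : P.map S = logNormal M V) (hQ : Q.map S = logNormal M₀ V₀) (hV : 0 < V) (hV₀ : 0 < V₀) :
    likelihoodRatio P Q =ᵐ[Q]
      fun ω => gaussianRatio M V.toNNReal M₀ V₀.toNNReal (Real.log (S ω)) := by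
  have hS : Measurable S := by rw [measurable_iff_comap_le]; exact hgen.ge
  have h := Measure.rnDeriv_withDensity Q (((measurable_gaussianRatio (M := M)
    (V := V.toNNReal) (M₀ := M₀) (V₀ := V₀.toNNReal)).ennreal_ofReal.comp
    Real.measurable_log).comp hS)
  have hE := eq_withDensity_of_map_eq_logNormal hgen hP hQ hV hV₀
  change (Q.withDensity fun ω => ENNReal.ofReal
      (gaussianRatio M V.toNNReal M₀ V₀.toNNReal (Real.log (S ω)))).rnDeriv Q =ᵐ[Q] _ at h
  rw [← hE] at h
  filter_upwards [h] with ω hω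
  rw [likelihoodRatio, hω]
  exact ENNReal.toReal_ofReal (gaussianRatio_pos (by simpa) (by simpa) _).le

end

/-! ### Expected logarithms and Gaussian second moments. -/

section LogExpectation

variable {Ω : Type*} [MeasurableSpace Ω] {μ : Measure Ω} [IsFiniteMeasure μ] {q : Ω → ℝ}

/-- The bound is uniform in `ε`, which makes it a dominating function for `ε → 0`. -/
lemma abs_log_add_exp_le {ε : ℝ} (h0 : 0 ≤ ε) (h1 : ε ≤ 1) (x : ℝ) :
    |Real.log (ε + Real.exp x)| ≤ Real.log 2 + |x| := by
  have hx := Real.exp_pos x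
  rw [abs_le]
  constructor
  · have h2 : x ≤ Real.log (ε + Real.exp x) := by
      rw [Real.le_log_iff_exp_le (by linarith)]; linarith
    have := neg_abs_le x
    have := Real.log_nonneg (show (1 : ℝ) ≤ 2 by norm_num)
    linarith
  · rw [Real.log_le_iff_le_exp (by linarith), Real.exp_add, Real.exp_log (by norm_num)]
    have h2 : Real.exp x ≤ Real.exp |x| := Real.exp_le_exp.2 (le_abs_self x)
    have h3 : 1 ≤ Real.exp |x| := Real.one_le_exp (abs_nonneg x)
    linarith

lemma integrable_log_add_exp (hq : Integrable q μ) {ε : ℝ} (h0 : 0 ≤ ε) (h1 : ε ≤ 1) :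
    Integrable (fun ω => Real.log (ε + Real.exp (q ω))) μ := by
  refine ((integrable_const (Real.log 2)).add hq.abs).mono' ?_
    (ae_of_all _ fun ω => abs_log_add_exp_le h0 h1 _)
  exact (Real.measurable_log.comp_aemeasurable
    ((Real.measurable_exp.comp_aemeasurable hq.1.aemeasurable).const_add ε)).aestronglyMeasurable

lemma tendsto_integral_log_add_exp (hq : Integrable q μ) :
    Tendsto (fun n : ℕ => ∫ ω, Real.log (1 / ((n : ℝ) + 1) + Real.exp (q ω)) ∂μ) atTop
      (𝓝 (∫ ω, q ω ∂μ)) := by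
  have hε : ∀ n : ℕ, 0 ≤ 1 / ((n : ℝ) + 1) ∧ 1 / ((n : ℝ) + 1) ≤ 1 := fun n =>
    ⟨by positivity, by rw [div_le_one (by positivity)]; linarith [n.cast_nonneg (α := ℝ)]⟩
  refine tendsto_integral_of_dominated_convergence (fun ω => Real.log 2 + |q ω|)
    (fun n => (integrable_log_add_exp hq (hε n).1 (hε n).2).1)
    ((integrable_const _).add hq.abs)
    (fun n => ae_of_all _ fun ω => abs_log_add_exp_le (hε n).1 (hε n).2 _)
    (ae_of_all _ fun ω => ?_)
  have h : Tendsto (fun n : ℕ => 1 / ((n : ℝ) + 1) + Real.exp (q ω)) atTop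
      (𝓝 (0 + Real.exp (q ω))) := tendsto_one_div_add_atTop_nhds_zero_nat.add_const _
  have h2 := h.log (by simp [Real.exp_ne_zero])
  simpa using h2

end LogExpectation

section GaussianMoments

variable {m : ℝ} {v : NNReal}

lemma integrable_sub_sq_gaussianReal (A : ℝ) :
    Integrable (fun y => (y - A) ^ 2) (gaussianReal m v) :=
  ((memLp_id_gaussianReal (μ := m) (v := v) 2).sub (memLp_const A)).integrable_sq

lemma integral_sub_sq_gaussianReal (A : ℝ) :
    ∫ y, (y - A) ^ 2 ∂(gaussianReal m v) = v + (m - A) ^ 2 := by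
  have h2 : MemLp id 2 (gaussianReal m v) := memLp_id_gaussianReal 2
  have hL : MemLp (fun y => y - A) 2 (gaussianReal m v) := h2.sub (memLp_const A)
  have hvar : Var[fun y => y - A; gaussianReal m v] = v := by
    rw [variance_sub_const (by fun_prop), variance_fun_id_gaussianReal]
  have hid : Integrable (fun y : ℝ => y) (gaussianReal m v) := h2.integrable (by norm_num)
  rw [variance_eq_sub hL, integral_sub hid (integrable_const _), integral_id_gaussianReal] at hvar
  simp only [Pi.pow_apply, integral_const, probReal_univ, smul_eq_mul, one_mul] at hvar
  linarith

end GaussianMoments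

/-! ### Integrals against a decreasing exponential. -/

section LayerCake

open scoped ENNReal

variable {ν : Measure ℝ} {κ C : ℝ}

lemma ofReal_exp_neg_eq_lintegral (hκ : 0 < κ) (y : ℝ) :
    ENNReal.ofReal (Real.exp (-(κ * y + C))) =
      ∫⁻ b in Ioi y, ENNReal.ofReal (κ * Real.exp (-(κ * b + C))) := by
  have hfun : (fun b => κ * Real.exp (-(κ * b + C))) =
      fun b => κ * Real.exp (-C) * Real.exp (-κ * b) := by
    ext b
    rw [mul_assoc, ← Real.exp_add]
    congr 2; ring
  have hint : IntegrableOn (fun b => κ * Real.exp (-(κ * b + C))) (Ioi y) := by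
    rw [hfun]
    exact (integrableOn_exp_mul_Ioi (by linarith) y).const_mul _
  rw [← ofReal_integral_eq_lintegral_ofReal hint (ae_of_all _ fun b => by positivity), hfun,
    integral_const_mul, integral_exp_mul_Ioi (by linarith)]
  congr 1
  rw [show -(κ * y + C) = -C + -κ * y by ring, Real.exp_add]
  field_simp

/-- Tonelli, after writing the exponential at `y` as the integral of minus its derivative over `b >
y`. -/
lemma lintegral_mul_exp_neg [SFinite ν] (hκ : 0 < κ) {g : ℝ → ℝ≥0∞} (hg : Measurable g) :
    ∫⁻ y, g y * ENNReal.ofReal (Real.exp (-(κ * y + C))) ∂ν =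
      ∫⁻ b, ENNReal.ofReal (κ * Real.exp (-(κ * b + C))) * ∫⁻ y in Iio b, g y ∂ν := by
  set v : ℝ → ℝ≥0∞ := fun b => ENNReal.ofReal (κ * Real.exp (-(κ * b + C)))
  have hv : Measurable v := by fun_prop
  have hmeas : Measurable fun p : ℝ × ℝ => {p : ℝ × ℝ | p.1 < p.2}.indicator
      (fun p => g p.1 * v p.2) p :=
    ((hg.comp measurable_fst).mul (hv.comp measurable_snd)).indicator
      (measurableSet_lt measurable_fst measurable_snd)
  calc ∫⁻ y, g y * ENNReal.ofReal (Real.exp (-(κ * y + C))) ∂ν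
      = ∫⁻ y, ∫⁻ b, {p : ℝ × ℝ | p.1 < p.2}.indicator (fun p => g p.1 * v p.2) (y, b) ∂volume ∂ν := by
        refine lintegral_congr fun y => ?_
        rw [ofReal_exp_neg_eq_lintegral hκ, ← lintegral_const_mul _ hv,
          ← lintegral_indicator measurableSet_Ioi]
        rfl
    _ = ∫⁻ b, ∫⁻ y, {p : ℝ × ℝ | p.1 < p.2}.indicator (fun p => g p.1 * v p.2) (y, b) ∂ν ∂volume :=
        lintegral_lintegral_swap hmeas.aemeasurable
    _ = _ := by
        refine lintegral_congr fun b => ?_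
        rw [← lintegral_const_mul _ hg, ← lintegral_indicator measurableSet_Iio]
        refine lintegral_congr fun y => ?_
        simp only [indicator, mem_ofPred_eq, mem_Iio, mul_comm (g y), v]

/-- Comparing lower partial integrals compares the integrals against a decreasing exponential. -/
lemma lintegral_mul_exp_neg_mono [SFinite ν] (hκ : 0 < κ) {h g : ℝ → ℝ≥0∞} (hh : Measurable h)
    (hg : Measurable g) (hle : ∀ b, ∫⁻ y in Iio b, h y ∂ν ≤ ∫⁻ y in Iio b, g y ∂ν) :
    ∫⁻ y, h y * ENNReal.ofReal (Real.exp (-(κ * y + C))) ∂ν ≤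
      ∫⁻ y, g y * ENNReal.ofReal (Real.exp (-(κ * y + C))) ∂ν := by
  rw [lintegral_mul_exp_neg hκ hh, lintegral_mul_exp_neg hκ hg]
  exact lintegral_mono fun b => mul_le_mul_right (hle b) _

lemma measurable_setLIntegral_Iio (g : ℝ → ℝ≥0∞) :
    Measurable fun b => ∫⁻ y in Iio b, g y ∂ν :=
  Monotone.measurable fun _ _ hab => lintegral_mono_set (Iio_subset_Iio hab)

/-- Equality in `lintegral_mul_exp_neg_mono` forces the functions to agree. -/
lemma ae_eq_of_lintegral_mul_exp_neg_le [SFinite ν] (hκ : 0 < κ) {h g : ℝ → ℝ≥0∞}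
    (hh : Measurable h) (hg : Measurable g)
    (hle : ∀ b, ∫⁻ y in Iio b, h y ∂ν ≤ ∫⁻ y in Iio b, g y ∂ν) (hfin : ∫⁻ y, h y ∂ν ≠ ∞)
    (hfin' : ∫⁻ y, h y * ENNReal.ofReal (Real.exp (-(κ * y + C))) ∂ν ≠ ∞)
    (hge : ∫⁻ y, g y * ENNReal.ofReal (Real.exp (-(κ * y + C))) ∂ν ≤
      ∫⁻ y, h y * ENNReal.ofReal (Real.exp (-(κ * y + C))) ∂ν) :
    h =ᵐ[ν] g := by
  rw [lintegral_mul_exp_neg hκ hh, lintegral_mul_exp_neg hκ hg] at hge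
  rw [lintegral_mul_exp_neg hκ hh] at hfin'
  have hv : Measurable fun b => ENNReal.ofReal (κ * Real.exp (-(κ * b + C))) := by fun_prop
  have hae := ae_eq_of_ae_le_of_lintegral_le (ae_of_all _ fun b => mul_le_mul_right (hle b) _)
    hfin' (hv.mul (measurable_setLIntegral_Iio g)).aemeasurable hge
  have hae' : ∀ᵐ b : ℝ, ∫⁻ y in Iio b, h y ∂ν = ∫⁻ y in Iio b, g y ∂ν := by
    filter_upwards [hae] with b hb
    refine (ENNReal.mul_right_inj ?_ ENNReal.ofReal_ne_top).1 hb
    rw [Ne, ENNReal.ofReal_eq_zero, not_le]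
    positivity
  have hα : ∀ u b, (ν.withDensity u) (Iio b) = ∫⁻ y in Iio b, u y ∂ν := fun u b =>
    withDensity_apply _ measurableSet_Iio
  have hall : ∀ b, (ν.withDensity h) (Iio b) = (ν.withDensity g) (Iio b) := by
    intro b
    refine le_antisymm (by rw [hα, hα]; exact hle b) ?_
    -- Equality holds for almost every `b`, hence on a dense set; increasing approximation of `b`
    -- within that set extends it to every `b`.
    obtain ⟨u, hu, hub, hlim⟩ :=
      (Measure.dense_of_ae hae').exists_seq_strictMono_tendsto b
    have hun : Iio b = ⋃ n, Iio (u n) := by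
      ext y
      simp only [mem_Iio, mem_iUnion]
      exact ⟨fun hy => (hlim.eventually_const_lt hy).exists,
        fun ⟨n, hn⟩ => hn.trans (hub n).1⟩
    have hm : Monotone fun n => Iio (u n) := fun _ _ hmn => Iio_subset_Iio (hu.monotone hmn)
    conv_lhs => rw [hun, hm.measure_iUnion]
    refine iSup_le fun n => ?_
    rw [hα, ← (hub n).2, ← hα]
    exact measure_mono (Iio_subset_Iio (hub n).1.le)
  -- Finiteness allows half-open intervals to be measured as differences of half-lines.
  have : IsFiniteMeasure (ν.withDensity h) := isFiniteMeasure_withDensity hfin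
  refine (withDensity_eq_iff hh.aemeasurable hg.aemeasurable hfin).1 ?_
  refine Measure.ext_of_Ico _ _ fun a b hab => ?_
  rw [← Iio_sdiff_Iio, measure_sdiff (Iio_subset_Iio hab.le) nullMeasurableSet_Iio
    (measure_ne_top _ _), measure_sdiff (Iio_subset_Iio hab.le) nullMeasurableSet_Iio
    (by rw [← hall]; exact measure_ne_top _ _), hall, hall]

end LayerCake

/-- If `h` is nondecreasing and `g` dominates `h` for all truncations, then the lower partial
integrals of `g` exceed those of `h`. -/
lemma setLIntegral_Iio_le_of_integral_min_le {ν : Measure ℝ} [IsProbabilityMeasure ν]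
    {h g : ℝ → ℝ} (hmono : Monotone h) (hh0 : ∀ y, 0 ≤ h y) (hg : Measurable g)
    (hg0 : ∀ y, 0 ≤ g y)
    (hmin : ∀ k, 0 ≤ k → ∫ y, min (h y) k ∂ν ≤ ∫ y, min (g y) k ∂ν) (b : ℝ) :
    ∫⁻ y in Iio b, ENNReal.ofReal (h y) ∂ν ≤ ∫⁻ y in Iio b, ENNReal.ofReal (g y) ∂ν := by
  -- At this level the truncation leaves `h` unchanged left of `b` and equals its maximum `k` right
  -- of `b`. There `g` cannot gain, so its advantage must lie left of `b`.
  set k := h b with hk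
  have hk0 : 0 ≤ k := hh0 b
  have hint : ∀ {u : ℝ → ℝ}, Measurable u → (∀ y, 0 ≤ u y) →
      Integrable (fun y => min (u y) k) ν := fun {u} hu hu0 =>
    (integrable_const k).mono' (hu.min measurable_const).aestronglyMeasurable
      (ae_of_all _ fun y => by
        rw [Real.norm_of_nonneg (le_min (hu0 y) hk0)]; exact min_le_right _ _)
  have hih := hint hmono.measurable hh0
  have hig := hint hg hg0
  have h1 := hmin k hk0
  rw [← integral_add_compl measurableSet_Iio hih (s := Iio b),
    ← integral_add_compl measurableSet_Iio hig (s := Iio b)] at h1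
  have h2 : ∫ y in (Iio b)ᶜ, min (g y) k ∂ν ≤ ∫ y in (Iio b)ᶜ, min (h y) k ∂ν := by
    refine setIntegral_mono_on hig.integrableOn hih.integrableOn measurableSet_Iio.compl
      fun y hy => ?_
    have : k ≤ h y := hmono (not_lt.1 hy)
    rw [min_eq_right this]
    exact min_le_right _ _
  have h3 : ∫ y in Iio b, min (h y) k ∂ν ≤ ∫ y in Iio b, min (g y) k ∂ν := by linarith
  calc ∫⁻ y in Iio b, ENNReal.ofReal (h y) ∂ν
      = ∫⁻ y in Iio b, ENNReal.ofReal (min (h y) k) ∂ν := by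
        refine setLIntegral_congr_fun measurableSet_Iio fun y hy => ?_
        rw [min_eq_left (hmono (le_of_lt hy))]
    _ = ENNReal.ofReal (∫ y in Iio b, min (h y) k ∂ν) :=
        (ofReal_integral_eq_lintegral_ofReal hih.integrableOn
          (ae_of_all _ fun y => le_min (hh0 y) hk0)).symm
    _ ≤ ENNReal.ofReal (∫ y in Iio b, min (g y) k ∂ν) := ENNReal.ofReal_le_ofReal h3
    _ = ∫⁻ y in Iio b, ENNReal.ofReal (min (g y) k) ∂ν :=
        ofReal_integral_eq_lintegral_ofReal hig.integrableOn
          (ae_of_all _ fun y => le_min (hg0 y) hk0)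
    _ ≤ ∫⁻ y in Iio b, ENNReal.ofReal (g y) ∂ν :=
        lintegral_mono fun y => ENNReal.ofReal_le_ofReal (min_le_left _ _)

/-! ### Distribution functions and quantiles. -/

section Cdf

lemma cdf_lt_one_of_strictMono {ν : Measure ℝ} (hmono : StrictMono (cdf ν)) (y : ℝ) : cdf ν y < 1 :=
  (hmono (lt_add_one y)).trans_le (cdf_le_one ν _)

lemma cdf_pos_of_strictMono {ν : Measure ℝ} (hmono : StrictMono (cdf ν)) (y : ℝ) : 0 < cdf ν y :=
  (cdf_nonneg ν _).trans_lt (hmono (sub_one_lt y))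

variable {ν : Measure ℝ} [IsProbabilityMeasure ν]

lemma continuous_cdf_of_measure_singleton (hν : ∀ x, ν {x} = 0) : Continuous (cdf ν) := by
  rw [continuous_iff_continuousAt]
  intro x
  rw [(cdf ν).mono.continuousAt_iff_leftLim_eq_rightLim, (cdf ν).rightLim_eq]
  refine le_antisymm ((cdf ν).mono.leftLim_le le_rfl) ?_
  have h := (cdf ν).measure_singleton x
  rw [measure_cdf, hν x, eq_comm, ENNReal.ofReal_eq_zero] at h
  linarith

lemma cdf_map_apply_of_strictMono {φ : ℝ → ℝ} (hφ : StrictMono φ) (y : ℝ) :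
    cdf (ν.map φ) (φ y) = cdf ν y := by
  have hm := hφ.monotone.measurable
  have := Measure.isProbabilityMeasure_map hm.aemeasurable (μ := ν)
  rw [cdf_eq_real, cdf_eq_real, map_measureReal_apply hm measurableSet_Iic]
  congr 1
  ext z
  simp [hφ.le_iff_le]

lemma strictMono_cdf_gaussianReal (m : ℝ) {v : NNReal} (hv : v ≠ 0) :
    StrictMono (cdf (gaussianReal m v)) := by
  intro a b hab
  have hsub : Iic a ⊆ Iic b := Iic_subset_Iic.2 hab.le
  have hpos : gaussianReal m v (Ioc a b) ≠ 0 := fun h => by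
    have := gaussianReal_absolutelyContinuous' m hv h
    rw [Real.volume_Ioc, ENNReal.ofReal_eq_zero] at this
    linarith
  rw [cdf_eq_real, cdf_eq_real, ← Iic_union_Ioc_eq_Iic hab.le,
    measureReal_union (Iic_disjoint_Ioc le_rfl) measurableSet_Ioc]
  have : 0 < (gaussianReal m v).real (Ioc a b) :=
    ENNReal.toReal_pos hpos (measure_ne_top _ _)
  linarith

/-- Keeps arguments of `quantile` below `1`, where the defining set could be empty and `sInf` would
return `0`. -/
lemma cdf_map_lt_one {φ : ℝ → ℝ} (hmono : StrictMono (cdf ν)) (hφ : StrictMono φ)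
    (htop : ∀ x, ∃ y, x ≤ φ y) (x : ℝ) : cdf (ν.map φ) x < 1 := by
  obtain ⟨y, hy⟩ := htop x
  refine (monotone_cdf _ hy).trans_lt ?_
  rw [cdf_map_apply_of_strictMono hφ]
  exact cdf_lt_one_of_strictMono hmono y

/-- The probability integral transform. -/
lemma map_cdf_eq_restrict (hmono : StrictMono (cdf ν)) (hcont : Continuous (cdf ν)) :
    ν.map (cdf ν) = volume.restrict (Ioo 0 1) := by
  have hm : Measurable (cdf ν) := hcont.measurable
  have hprob := Measure.isProbabilityMeasure_map hm.aemeasurable (μ := ν)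
  refine Measure.ext_of_Iic _ _ fun p => ?_
  rw [Measure.map_apply hm measurableSet_Iic, Measure.restrict_apply measurableSet_Iic]
  rcases le_or_gt p 0 with hp0 | hp0
  · have h1 : cdf ν ⁻¹' Iic p = ∅ := by
      ext y
      simpa using hp0.trans_lt (cdf_pos_of_strictMono hmono y)
    have h2 : Iic p ∩ Ioo 0 1 = ∅ := by
      ext y
      simp only [mem_inter_iff, mem_Iic, mem_Ioo, mem_empty_iff_false, iff_false]
      intro h
      linarith [h.1, h.2.1]
    rw [h1, h2, measure_empty, measure_empty]
  rcases le_or_gt 1 p with hp1 | hp1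
  · have h1 : cdf ν ⁻¹' Iic p = univ := by
      ext y
      simpa using (cdf_le_one ν y).trans hp1
    have h2 : Iic p ∩ Ioo 0 1 = Ioo 0 1 := inter_eq_right.2 fun y hy => hy.2.le.trans hp1
    rw [h1, h2, measure_univ, Real.volume_Ioo]
    simp
  · obtain ⟨y, rfl⟩ : ∃ y, cdf ν y = p :=
      mem_range_of_exists_le_of_exists_ge hcont
        (((tendsto_cdf_atBot ν).eventually_lt_const hp0).exists.imp fun _ h => h.le)
        (((tendsto_cdf_atTop ν).eventually_const_lt hp1).exists.imp fun _ h => h.le)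
    have h1 : cdf ν ⁻¹' Iic (cdf ν y) = Iic y := by
      ext z
      simp [hmono.le_iff_le]
    have h2 : Iic (cdf ν y) ∩ Ioo 0 1 = Ioc 0 (cdf ν y) := by
      ext u
      simp only [mem_inter_iff, mem_Iic, mem_Ioo, mem_Ioc]
      constructor
      · rintro ⟨h, h', -⟩; exact ⟨h', h⟩
      · rintro ⟨h, h'⟩; exact ⟨h', h, h'.trans_lt hp1⟩
    rw [h1, h2, ← ofReal_cdf, Real.volume_Ioc, sub_zero]

end Cdf

section Quantile

variable {F : StieltjesFunction ℝ}

lemma quantile_nonneg (F : StieltjesFunction ℝ) (p : ℝ) : 0 ≤ quantile F p :=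
  Real.sInf_nonneg fun _ hx => hx.1

lemma quantile_set_nonempty (hF : IsDistributionFunction F) {p : ℝ} (hp : p < 1) :
    {x : ℝ | 0 ≤ x ∧ p ≤ F x}.Nonempty := by
  obtain ⟨x, hx, h0⟩ := ((hF.2.eventually_const_lt hp).and (eventually_ge_atTop 0)).exists
  exact ⟨x, h0, hx.le⟩

/-- Right-continuity makes the infimum attained; `p < 1` makes the set nonempty. -/
lemma quantile_le_iff (hF : IsDistributionFunction F) {p x : ℝ} (hp : p < 1) (hx : 0 ≤ x) :
    quantile F p ≤ x ↔ p ≤ F x := by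
  refine ⟨fun h => ?_, fun h => csInf_le ⟨0, fun _ hy => hy.1⟩ ⟨hx, h⟩⟩
  refine le_trans ?_ (F.mono h)
  refine ge_of_tendsto ((F.right_continuous _).mono_left (nhdsWithin_mono _ Ioi_subset_Ici_self))
    ?_
  filter_upwards [self_mem_nhdsWithin] with z hz
  obtain ⟨y, hy, hyz⟩ := exists_lt_of_csInf_lt (quantile_set_nonempty hF hp) hz
  exact hy.2.trans (F.mono hyz.le)

lemma monotoneOn_quantile (hF : IsDistributionFunction F) : MonotoneOn (quantile F) (Iio 1) :=
  fun _ _ _ hb hab => csInf_le_csInf ⟨0, fun _ hy => hy.1⟩ (quantile_set_nonempty hF hb)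
    fun _ hx => ⟨hx.1, hab.trans hx.2⟩

lemma aemeasurable_quantile (hF : IsDistributionFunction F) :
    AEMeasurable (quantile F) (volume.restrict (Ioo 0 1)) :=
  aemeasurable_restrict_of_monotoneOn measurableSet_Ioo
    ((monotoneOn_quantile hF).mono fun _ h => h.2)

/-- The quantile function of a uniform variable has distribution function `F`. -/
lemma map_quantile_eq (hF : IsDistributionFunction F) (hneg : ∀ x < 0, F x = 0) :
    (volume.restrict (Ioo 0 1)).map (quantile F) = F.measure := by
  have hm := aemeasurable_quantile hF
  have hfin : IsFiniteMeasure ((volume.restrict (Ioo (0 : ℝ) 1)).map (quantile F)) := by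
    infer_instance
  refine Measure.ext_of_Iic _ _ fun x => ?_
  rw [Measure.map_apply_of_aemeasurable hm measurableSet_Iic, F.measure_Iic hF.1, sub_zero,
    Measure.restrict_apply' measurableSet_Ioo]
  rcases lt_or_ge x 0 with hx | hx
  · have : quantile F ⁻¹' Iic x ∩ Ioo 0 1 = ∅ := by
      ext u
      simp only [mem_inter_iff, mem_preimage, mem_Iic, mem_empty_iff_false, iff_false]
      intro h
      linarith [h.1, quantile_nonneg F u]
    rw [this, hneg x hx]
    simp
  · have hF1 : F x ≤ 1 := F.mono.ge_of_tendsto hF.2 x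
    have h1 : quantile F ⁻¹' Iic x ∩ Ioo 0 1 = Iic (F x) ∩ Ioo 0 1 := by
      ext u
      simp only [mem_inter_iff, mem_preimage, mem_Iic]
      exact and_congr_left fun hu => quantile_le_iff hF hu.2 hx
    rw [h1]
    -- The set lies between `Ioo 0 (F x)` and `Ioc 0 (F x)`, which have equal length; this covers `F
    -- x = 1` too.
    refine le_antisymm ((measure_mono (t := Ioc 0 (F x)) fun u hu => ⟨hu.2.1, hu.1⟩).trans_eq
      (by simp)) ((measure_mono (show Ioo 0 (F x) ⊆ Iic (F x) ∩ Ioo 0 1 from fun u hu =>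
        ⟨hu.2.le, hu.1, hu.2.trans_le hF1⟩)).trans_eq' (by simp))

end Quantile

/-! ### Expectations of functions of `S` as Gaussian integrals. -/

section Payoffs

variable {Ω : Type*} [mΩ : MeasurableSpace Ω] {S : Ω → ℝ} {P P' Q : Measure Ω}
  {M M' M₀ V V' V₀ κ C : ℝ}

section LogNormal

lemma aestronglyMeasurable_logNormal_of_mem_SSD {f : ℝ → ℝ} (hf : f ∈ SSD) :
    AEStronglyMeasurable f (logNormal M V) := by
  refine aestronglyMeasurable_of_mem_SSD hf ?_
  rw [logNormal, ae_map_iff (by fun_prop) measurableSet_Ici]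
  exact ae_of_all _ fun y => (Real.exp_pos y).le

lemma integrable_comp_iff_of_map_eq_logNormal (hS : Measurable S) (hP : P.map S = logNormal M V)
    {f : ℝ → ℝ} (hf : AEStronglyMeasurable f (logNormal M V)) :
    Integrable (fun ω => f (S ω)) P ↔
      Integrable (fun y => f (Real.exp y)) (gaussianReal M V.toNNReal) := by
  have h1 := integrable_map_measure (hP ▸ hf) hS.aemeasurable
  have h2 := integrable_map_measure (f := Real.exp) hf Real.measurable_exp.aemeasurable
  rw [hP] at h1
  exact h1.symm.trans h2

lemma integral_comp_of_map_eq_logNormal (hS : Measurable S) (hP : P.map S = logNormal M V)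
    {f : ℝ → ℝ} (hf : AEStronglyMeasurable f (logNormal M V)) :
    ∫ ω, f (S ω) ∂P = ∫ y, f (Real.exp y) ∂(gaussianReal M V.toNNReal) := by
  rw [← integral_map hS.aemeasurable (hP ▸ hf), hP, logNormal,
    integral_map Real.measurable_exp.aemeasurable hf]

lemma integral_comp_le_of_map_eq_logNormal (hS : Measurable S) (hP : P.map S = logNormal M V)
    (hP' : P'.map S = logNormal M' V') (hV' : 0 ≤ V') (hV : V' ≤ V)
    (hM : M + V / 2 ≤ M' + V' / 2) {f : ℝ → ℝ} (hf : f ∈ SSD)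
    (hi : Integrable (fun ω => f (S ω)) P) (hi' : Integrable (fun ω => f (S ω)) P') :
    ∫ ω, f (S ω) ∂P ≤ ∫ ω, f (S ω) ∂P' := by
  have hm := aestronglyMeasurable_logNormal_of_mem_SSD (M := M) (V := V) hf
  have hm' := aestronglyMeasurable_logNormal_of_mem_SSD (M := M') (V := V') hf
  rw [integrable_comp_iff_of_map_eq_logNormal hS hP hm] at hi
  rw [integrable_comp_iff_of_map_eq_logNormal hS hP' hm'] at hi'
  rw [integral_comp_of_map_eq_logNormal hS hP hm, integral_comp_of_map_eq_logNormal hS hP' hm']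
  refine integral_exp_gaussianReal_le (Real.toNNReal_le_toNNReal hV) ?_ hf hi hi'
  rwa [Real.coe_toNNReal _ hV', Real.coe_toNNReal _ (hV'.trans hV)]

/-- The comparison of `integral_comp_le_of_map_eq_logNormal` for a power of `S` with exponent
in `(0, 1]`. -/
lemma integral_comp_exp_log_le (hS : Measurable S) (hP : P.map S = logNormal M V)
    (hP' : P'.map S = logNormal M' V') (hV' : 0 ≤ V') (hV : V' ≤ V)
    (hM : M + V / 2 ≤ M' + V' / 2) (hκ0 : 0 ≤ κ) (hκ1 : κ ≤ 1) {ℓ : Ω → ℝ}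
    (hℓ : ℓ =ᵐ[P] fun ω => Real.exp (κ * Real.log (S ω) + C))
    (hℓ' : ℓ =ᵐ[P'] fun ω => Real.exp (κ * Real.log (S ω) + C)) {f : ℝ → ℝ} (hf : f ∈ SSD)
    (hi : Integrable (fun ω => f (ℓ ω)) P) (hi' : Integrable (fun ω => f (ℓ ω)) P') :
    ∫ ω, f (ℓ ω) ∂P ≤ ∫ ω, f (ℓ ω) ∂P' := by
  have hcomp : (fun x : ℝ => f (Real.exp C * x ^ κ)) ∈ SSD :=
    comp_mem_SSD hf (rpow_mem_SSD (Real.exp_pos C).le hκ0 hκ1) fun x hx => by positivity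
  have hae : ∀ {R : Measure Ω} {m v : ℝ}, R.map S = logNormal m v →
      (ℓ =ᵐ[R] fun ω => Real.exp (κ * Real.log (S ω) + C)) →
      (fun ω => f (ℓ ω)) =ᵐ[R] fun ω => f (Real.exp C * S ω ^ κ) := by
    intro R m v hR h
    filter_upwards [ae_pos_of_map_eq_logNormal hS hR, h] with ω hpos hω
    rw [hω, Real.rpow_def_of_pos hpos, ← Real.exp_add]
    congr 2
    ring
  rw [integral_congr_ae (hae hP hℓ), integral_congr_ae (hae hP' hℓ')]
  exact integral_comp_le_of_map_eq_logNormal hS hP hP' hV' hV hM hcomp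
    (hi.congr (hae hP hℓ)) (hi'.congr (hae hP' hℓ'))

lemma lintegral_comp_of_map_eq_logNormal (hS : Measurable S) (hP : P.map S = logNormal M V)
    {f : ℝ → ENNReal} (hf : Measurable f) :
    ∫⁻ ω, f (S ω) ∂P = ∫⁻ y, f (Real.exp y) ∂(gaussianReal M V.toNNReal) := by
  rw [← lintegral_map hf hS, hP, logNormal, lintegral_map hf Real.measurable_exp]

/-- Pricing as an integral under the law `N(M, V)`: with equal variances the density of `N(M₀, V)`
is the exponential of an affine function, decreasing when `M₀ < M`. -/
lemma exists_lintegral_eq_lintegral_mul_exp_neg (hS : Measurable S)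
    (hQ : Q.map S = logNormal M₀ V) (M : ℝ) (hV : 0 < V) :
    ∃ C, ∀ f : ℝ → ENNReal, Measurable f →
      ∫⁻ ω, f (S ω) ∂Q = ∫⁻ y, f (Real.exp y) *
        ENNReal.ofReal (Real.exp (-((M - M₀) / V * y + C))) ∂(gaussianReal M V.toNNReal) := by
  have hV' : V.toNNReal ≠ 0 := by simpa
  obtain ⟨C, hC⟩ := exists_gaussianRatio_eq_exp_affine M₀ M hV'
  refine ⟨-C, fun f hf => ?_⟩
  have hfe : Measurable fun y => f (Real.exp y) := hf.comp Real.measurable_exp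
  rw [lintegral_comp_of_map_eq_logNormal hS hQ hf,
    gaussianReal_eq_withDensity_gaussianRatio (M₀ := M) hV' hV',
    lintegral_withDensity_eq_lintegral_mul _ measurable_gaussianRatio.ennreal_ofReal
      hfe]
  refine lintegral_congr fun y => ?_
  rw [Pi.mul_apply, mul_comm, hC y, Real.coe_toNNReal _ hV.le]
  congr 3
  ring

end LogNormal

/-- If the law of the likelihood ratio `dP'/dQ` under `P'` is dominated by its law under `P`,
where `P` has the log-variance of `Q` and a log-mean between those of `Q` and `P'`, then `P` and
`P'` have the same parameters. -/
lemma eq_of_integralOrder_likelihoodRatio [IsProbabilityMeasure P] [IsProbabilityMeasure P']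
    [IsProbabilityMeasure Q] (hgen : mΩ = MeasurableSpace.comap S inferInstance)
    (hP : P.map S = logNormal M V) (hP' : P'.map S = logNormal M' V')
    (hQ : Q.map S = logNormal M₀ V) (hV' : 0 < V') (hV : V' ≤ V) (hM₀ : M₀ ≤ M) (hM : M ≤ M')
    (hord : IntegralOrder SSD (distFun P' (likelihoodRatio P' Q))
      (distFun P (likelihoodRatio P' Q))) :
    M' = M ∧ V' = V := by
  have hV0 : 0 < V := hV'.trans_le hV
  have hS : Measurable S := by rw [measurable_iff_comap_le]; exact hgen.ge
  have hn : V.toNNReal ≠ 0 := by simpa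
  have hn' : V'.toNNReal ≠ 0 := by simpa
  obtain ⟨C, hC⟩ := exists_gaussianRatio_eq_exp M' M₀ hn' hn
  rw [Real.coe_toNNReal _ hV0.le, Real.coe_toNNReal _ hV'.le] at hC
  set q : ℝ → ℝ := fun y => C - (y - M') ^ 2 / (2 * V') + (y - M₀) ^ 2 / (2 * V) with hq
  have hℓ : likelihoodRatio P' Q =ᵐ[Q] fun ω => Real.exp (q (Real.log (S ω))) := by
    filter_upwards [likelihoodRatio_ae_eq hgen hP' hQ hV' hV0] with ω hω
    rw [hω, hC]
  have hqi : ∀ m v, Integrable q (gaussianReal m v) := fun m v =>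
    ((integrable_const C).sub ((integrable_sub_sq_gaussianReal M').div_const _)).add
      ((integrable_sub_sq_gaussianReal M₀).div_const _)
  have hqint : ∀ m (v : NNReal), ∫ y, q y ∂(gaussianReal m v) =
      C - (v + (m - M') ^ 2) / (2 * V') + (v + (m - M₀) ^ 2) / (2 * V) := fun m v => by
    have h1 := (integrable_sub_sq_gaussianReal (m := m) (v := v) M').div_const (2 * V')
    have h2 := (integrable_sub_sq_gaussianReal (m := m) (v := v) M₀).div_const (2 * V)
    have h3 : Integrable (fun y => C - (y - M') ^ 2 / (2 * V')) (gaussianReal m v) :=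
      (integrable_const C).sub h1
    rw [hq, integral_add h3 h2, integral_sub (integrable_const C) h1,
      integral_div, integral_div, integral_sub_sq_gaussianReal, integral_sub_sq_gaussianReal]
    simp
  have hℓm : Measurable (likelihoodRatio P' Q) :=
    (Measure.measurable_rnDeriv P' Q).ennreal_toReal
  have hℓ0 : ∀ ω, 0 ≤ likelihoodRatio P' Q ω := fun _ => ENNReal.toReal_nonneg
  rw [integralOrder_distFun_iff hℓm.aemeasurable (ae_of_all _ hℓ0) hℓm.aemeasurable
    (ae_of_all _ hℓ0)] at hord
  -- Along `ε = 1 / (n + 1)` the admissible tests `log (ε + ·)` recover the expected log-likelihood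
  -- ratio, for both `P'` and `P`.
  have key : ∀ {N : Measure Ω} {m v : ℝ} (_ : IsProbabilityMeasure N) (_ : N.map S = logNormal m v)
      (_ : 0 < v),
      (∀ ε, 0 ≤ ε → ε ≤ 1 →
        Integrable (fun ω => Real.log (ε + likelihoodRatio P' Q ω)) N) ∧
      Tendsto (fun n : ℕ => ∫ ω, Real.log (1 / ((n : ℝ) + 1) + likelihoodRatio P' Q ω) ∂N) atTop
        (𝓝 (∫ y, q y ∂(gaussianReal m v.toNNReal))) := by
    intro N m v hN hNS hv
    have hae := (absolutelyContinuous_of_map_eq_logNormal hgen hNS hQ hv hV0).ae_eq hℓ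
    have hlog := map_log_of_map_eq_logNormal hS hNS
    have hlm : AEMeasurable (fun ω => Real.log (S ω)) N :=
      (Real.measurable_log.comp hS).aemeasurable
    have hqN : Integrable (fun ω => q (Real.log (S ω))) N := by
      have := hqi m v.toNNReal
      rw [← hlog] at this
      exact (integrable_map_measure this.1 hlm).1 this
    have haeε : ∀ ε, (fun ω => Real.log (ε + Real.exp (q (Real.log (S ω))))) =ᵐ[N]
        fun ω => Real.log (ε + likelihoodRatio P' Q ω) := fun ε => by
      filter_upwards [hae] with ω hω
      rw [hω]
    refine ⟨fun ε h0 h1 => (integrable_log_add_exp hqN h0 h1).congr (haeε ε), ?_⟩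
    have ht := tendsto_integral_log_add_exp hqN
    have hqe : ∫ ω, q (Real.log (S ω)) ∂N = ∫ y, q y ∂(gaussianReal m v.toNNReal) := by
      rw [← hlog, integral_map hlm]
      rw [hlog]
      exact (hqi _ _).1
    rw [hqe] at ht
    exact ht.congr fun n => integral_congr_ae (haeε _)
  obtain ⟨hi', ht'⟩ := key ‹_› hP' hV'
  obtain ⟨hi, ht⟩ := key ‹_› hP hV0
  have hle := le_of_tendsto_of_tendsto' ht' ht fun n => by
    have h0 : 0 < 1 / ((n : ℝ) + 1) := by positivity
    have h1 : 1 / ((n : ℝ) + 1) ≤ 1 := by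
      rw [div_le_one (by positivity)]; linarith [n.cast_nonneg (α := ℝ)]
    exact hord _ (log_add_mem_SSD h0) (hi' _ h0.le h1) (hi _ h0.le h1)
  rw [hqint, hqint, Real.coe_toNNReal _ hV0.le, Real.coe_toNNReal _ hV'.le] at hle
  -- Clearing denominators with `2 * V' * V`. All three terms are nonnegative, the last because `M₀
  -- ≤ M ≤ M'`.
  have hpoly : (V - V') ^ 2 + V * (M - M') ^ 2 + V' * ((M' - M₀) ^ 2 - (M - M₀) ^ 2) ≤ 0 := by
    have h := mul_le_mul_of_nonneg_left hle (show 0 ≤ 2 * V' * V by positivity)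
    have e1 : 2 * V' * V * (C - (V' + (M' - M') ^ 2) / (2 * V') + (V' + (M' - M₀) ^ 2) / (2 * V)) =
        2 * V' * V * C - V * V' + V' * (V' + (M' - M₀) ^ 2) := by
      field_simp
      ring
    have e2 : 2 * V' * V * (C - (V + (M - M') ^ 2) / (2 * V') + (V + (M - M₀) ^ 2) / (2 * V)) =
        2 * V' * V * C - V * (V + (M - M') ^ 2) + V' * (V + (M - M₀) ^ 2) := by
      field_simp
    rw [e1, e2] at h
    linarith
  have h3 : 0 ≤ V' * ((M' - M₀) ^ 2 - (M - M₀) ^ 2) :=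
    mul_nonneg hV'.le (by nlinarith)
  have h4 : 0 ≤ V * (M - M') ^ 2 := by positivity
  have h5 : (V - V') ^ 2 = 0 := le_antisymm (by linarith) (sq_nonneg _)
  have h6 : V * (M - M') ^ 2 = 0 := le_antisymm (by linarith [sq_nonneg (V - V')]) h4
  have h7 : (M - M') ^ 2 = 0 := (mul_eq_zero.1 h6).resolve_left hV0.ne'
  exact ⟨by linarith [pow_eq_zero_iff two_ne_zero |>.1 h7],
    by linarith [pow_eq_zero_iff two_ne_zero |>.1 h5]⟩

/-! ### Cheapest payoffs. -/

section Cost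

variable {H g : ℝ → ℝ}

lemma setLIntegral_Iio_exp_le (hS : Measurable S) (hP : P.map S = logNormal M V)
    (hH : Monotone H) (hH0 : ∀ x, 0 ≤ H x) (hg : Measurable g)
    (hg0 : ∀ x, 0 ≤ x → 0 ≤ g x)
    (hmin : ∀ k, 0 ≤ k → ∫ ω, min (H (S ω)) k ∂P ≤ ∫ ω, min (g (S ω)) k ∂P) (b : ℝ) :
    ∫⁻ y in Iio b, ENNReal.ofReal (H (Real.exp y)) ∂(gaussianReal M V.toNNReal) ≤
      ∫⁻ y in Iio b, ENNReal.ofReal (g (Real.exp y)) ∂(gaussianReal M V.toNNReal) := by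
  refine setLIntegral_Iio_le_of_integral_min_le (h := fun y => H (Real.exp y))
    (g := fun y => g (Real.exp y)) (hH.comp Real.exp_monotone) (fun y => hH0 _)
    (hg.comp Real.measurable_exp) (fun y => hg0 _ (Real.exp_pos y).le) (fun k hk => ?_) b
  have h := hmin k hk
  rwa [integral_comp_of_map_eq_logNormal hS hP (f := fun x => min (H x) k)
      (hH.measurable.min measurable_const).aestronglyMeasurable,
    integral_comp_of_map_eq_logNormal hS hP (f := fun x => min (g x) k)
      (hg.min measurable_const).aestronglyMeasurable] at h

/-- Among the payoffs whose truncated expectations under `P` dominate those of a nondecreasing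
payoff `H(S)`, the latter has the least expectation under `Q`. -/
lemma integral_le_of_integral_min_le (hS : Measurable S) (hS0 : ∀ ω, 0 ≤ S ω)
    (hP : P.map S = logNormal M V) (hQ : Q.map S = logNormal M₀ V) (hV : 0 < V) (hM : M₀ < M)
    (hH : Monotone H) (hH0 : ∀ x, 0 ≤ H x) (hg : Measurable g) (hg0 : ∀ x, 0 ≤ x → 0 ≤ g x)
    (hgi : Integrable (fun ω => g (S ω)) Q)
    (hmin : ∀ k, 0 ≤ k → ∫ ω, min (H (S ω)) k ∂P ≤ ∫ ω, min (g (S ω)) k ∂P) :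
    ∫ ω, H (S ω) ∂Q ≤ ∫ ω, g (S ω) ∂Q := by
  obtain ⟨C, hC⟩ := exists_lintegral_eq_lintegral_mul_exp_neg hS hQ M hV
  have hHm := hH.measurable
  rw [integral_eq_lintegral_of_nonneg_ae (ae_of_all _ fun ω => hH0 _)
    (hHm.comp hS).aestronglyMeasurable, integral_eq_lintegral_of_nonneg_ae
    (ae_of_all _ fun ω => hg0 _ (hS0 ω)) hgi.1]
  refine ENNReal.toReal_mono hgi.lintegral_lt_top.ne ?_
  rw [hC (fun x => ENNReal.ofReal (H x)) hHm.ennreal_ofReal,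
    hC (fun x => ENNReal.ofReal (g x)) hg.ennreal_ofReal]
  exact lintegral_mul_exp_neg_mono (div_pos (sub_pos.2 hM) hV)
    (hHm.comp Real.measurable_exp).ennreal_ofReal (hg.comp Real.measurable_exp).ennreal_ofReal
    (setLIntegral_Iio_exp_le hS hP hH hH0 hg hg0 hmin)

/-- The equality case of the layer-cake comparison. Integrability of `H(S)` under `P` makes the
partial integrals finite, and under `Q` the mixture. -/
lemma ae_eq_of_integral_le_of_integral_min_le (hS : Measurable S) (hS0 : ∀ ω, 0 ≤ S ω)
    (hP : P.map S = logNormal M V) (hQ : Q.map S = logNormal M₀ V) (hV : 0 < V) (hM : M₀ < M)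
    (hH : Monotone H) (hH0 : ∀ x, 0 ≤ H x) (hg : Measurable g) (hg0 : ∀ x, 0 ≤ x → 0 ≤ g x)
    (hHiP : Integrable (fun ω => H (S ω)) P) (hHi : Integrable (fun ω => H (S ω)) Q)
    (hgi : Integrable (fun ω => g (S ω)) Q)
    (hmin : ∀ k, 0 ≤ k → ∫ ω, min (H (S ω)) k ∂P ≤ ∫ ω, min (g (S ω)) k ∂P)
    (hge : ∫ ω, g (S ω) ∂Q ≤ ∫ ω, H (S ω) ∂Q) :
    (fun ω => g (S ω)) =ᵐ[P] fun ω => H (S ω) := by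
  obtain ⟨C, hC⟩ := exists_lintegral_eq_lintegral_mul_exp_neg hS hQ M hV
  have hHm := hH.measurable
  have hHfin := hHi.lintegral_lt_top.ne
  have hle : ∫⁻ ω, ENNReal.ofReal (g (S ω)) ∂Q ≤ ∫⁻ ω, ENNReal.ofReal (H (S ω)) ∂Q := by
    rw [← ofReal_integral_eq_lintegral_ofReal hgi (ae_of_all _ fun ω => hg0 _ (hS0 ω)),
      ← ofReal_integral_eq_lintegral_ofReal hHi (ae_of_all _ fun ω => hH0 _)]
    exact ENNReal.ofReal_le_ofReal hge
  have hHP := hHiP.lintegral_lt_top.ne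
  rw [lintegral_comp_of_map_eq_logNormal hS hP (f := fun x => ENNReal.ofReal (H x))
    hHm.ennreal_ofReal] at hHP
  rw [hC (fun x => ENNReal.ofReal (H x)) hHm.ennreal_ofReal] at hHfin
  rw [hC (fun x => ENNReal.ofReal (H x)) hHm.ennreal_ofReal,
    hC (fun x => ENNReal.ofReal (g x)) hg.ennreal_ofReal] at hle
  have hae := ae_eq_of_lintegral_mul_exp_neg_le (div_pos (sub_pos.2 hM) hV)
    (hHm.comp Real.measurable_exp).ennreal_ofReal (hg.comp Real.measurable_exp).ennreal_ofReal
    (setLIntegral_Iio_exp_le hS hP hH hH0 hg hg0 hmin) hHP hHfin hle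
  rw [← map_log_of_map_eq_logNormal hS hP] at hae
  filter_upwards [ae_of_ae_map (Real.measurable_log.comp hS).aemeasurable hae,
    ae_pos_of_map_eq_logNormal hS hP] with ω hω hpos
  simp only [Function.comp_apply, Real.exp_log hpos] at hω
  exact ((ENNReal.ofReal_eq_ofReal_iff (hH0 _) (hg0 _ hpos.le)).1 hω).symm

end Cost

end Payoffs

/-! ### The quantile payoff: law, integrability and truncated expectations. -/

section QuantileCdf

variable {F : StieltjesFunction ℝ} {ν : Measure ℝ} [IsProbabilityMeasure ν]

lemma monotone_quantile_comp (hF : IsDistributionFunction F) {G : ℝ → ℝ} (hG : Monotone G)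
    (hG1 : ∀ x, G x < 1) : Monotone fun x => quantile F (G x) :=
  fun _ _ hxy => monotoneOn_quantile hF (hG1 _) (hG1 _) (hG hxy)

lemma memLp_quantile_cdf (hF : IsDistributionFunction F)
    (hint : IntegrableOn (fun u => quantile F u ^ 2) (Ioo 0 1))
    (hmono : StrictMono (cdf ν)) (hcont : Continuous (cdf ν)) :
    MemLp (fun y => quantile F (cdf ν y)) 2 ν := by
  have h : MemLp (quantile F) 2 (volume.restrict (Ioo 0 1)) :=
    (memLp_two_iff_integrable_sq (aemeasurable_quantile hF).aestronglyMeasurable).2 hint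
  rw [← map_cdf_eq_restrict hmono hcont] at h
  exact (memLp_map_measure_iff h.1 hcont.measurable.aemeasurable).1 h

lemma map_quantile_cdf (hF : IsDistributionFunction F) (hneg : ∀ x < 0, F x = 0)
    (hmono : StrictMono (cdf ν)) (hcont : Continuous (cdf ν)) :
    ν.map (fun y => quantile F (cdf ν y)) = F.measure := by
  have hm := aemeasurable_quantile hF
  rw [← map_quantile_eq hF hneg, ← map_cdf_eq_restrict hmono hcont] at *
  exact (AEMeasurable.map_map_of_aemeasurable hm hcont.measurable.aemeasurable).symm

end QuantileCdf

lemma strictMono_exp_affine {κ : ℝ} (hκ : 0 < κ) (C : ℝ) :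
    StrictMono fun y => Real.exp (κ * y + C) := fun a b hab =>
  Real.exp_lt_exp.2 (by nlinarith)

lemma exists_le_exp_affine {κ : ℝ} (hκ : 0 < κ) (C x : ℝ) : ∃ y, x ≤ Real.exp (κ * y + C) := by
  refine ⟨(x - C) / κ, ?_⟩
  rw [mul_div_cancel₀ _ hκ.ne', sub_add_cancel]
  linarith [Real.add_one_le_exp x]

lemma memLp_exp_neg_affine_gaussianReal (m : ℝ) (v : NNReal) (κ C : ℝ) :
    MemLp (fun y => Real.exp (-(κ * y + C))) 2 (gaussianReal m v) := by
  rw [memLp_two_iff_integrable_sq (by fun_prop)]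
  have h := (integrable_exp_mul_gaussianReal (μ := m) (v := v) (-2 * κ)).const_mul
    (Real.exp (-2 * C))
  refine h.congr (ae_of_all _ fun y => ?_)
  simp only
  rw [← Real.exp_add, ← Real.exp_nat_mul]
  congr 1
  push_cast
  ring

section Payoff

variable {Ω : Type*} [mΩ : MeasurableSpace Ω] {S : Ω → ℝ} {P Q : Measure Ω} {M M₀ V : ℝ}
  {F : StieltjesFunction ℝ}

lemma continuous_cdf_gaussianReal (m : ℝ) {v : NNReal} (hv : v ≠ 0) :
    Continuous (cdf (gaussianReal m v)) :=
  have := nullSingletonClass_gaussianReal (μ := m) hv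
  continuous_cdf_of_measure_singleton fun x => measure_singleton x

lemma distFun_lt_one (hP : P.map S = logNormal M V) (hV : 0 < V) (x : ℝ) :
    distFun P S x < 1 := by
  rw [distFun, hP]
  refine cdf_map_lt_one (strictMono_cdf_gaussianReal M (by simpa)) Real.exp_strictMono
    (fun x => ⟨x, ?_⟩) x
  linarith [Real.add_one_le_exp x]

lemma distFun_exp (hP : P.map S = logNormal M V) (y : ℝ) :
    distFun P S (Real.exp y) = cdf (gaussianReal M V.toNNReal) y := by
  rw [distFun, hP]
  exact cdf_map_apply_of_strictMono Real.exp_strictMono y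

lemma monotone_quantile_distFun (hF : IsDistributionFunction F) (hP : P.map S = logNormal M V)
    (hV : 0 < V) : Monotone fun x => quantile F (distFun P S x) :=
  monotone_quantile_comp hF (distFun P S).mono (distFun_lt_one hP hV)

lemma map_quantile_distFun (hS : Measurable S) (hF : IsDistributionFunction F)
    (hneg : ∀ x < 0, F x = 0) (hP : P.map S = logNormal M V) (hV : 0 < V) :
    P.map (fun ω => quantile F (distFun P S (S ω))) = F.measure := by
  have hm := (monotone_quantile_distFun hF hP hV).measurable
  have h1 : P.map (fun ω => quantile F (distFun P S (S ω))) =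
      (P.map S).map fun x => quantile F (distFun P S x) := (Measure.map_map hm hS).symm
  have h2 : ((fun x => quantile F (distFun P S x)) ∘ Real.exp) =
      fun y => quantile F (cdf (gaussianReal M V.toNNReal) y) := by
    ext y
    simp only [Function.comp_apply, distFun_exp hP]
  have hv : V.toNNReal ≠ 0 := by simpa
  rw [h1, hP, logNormal, Measure.map_map hm Real.measurable_exp, h2]
  exact map_quantile_cdf hF hneg (strictMono_cdf_gaussianReal M hv)
    (continuous_cdf_gaussianReal M hv)

lemma distFun_quantile_distFun (hS : Measurable S) (hF : IsDistributionFunction F)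
    (hneg : ∀ x < 0, F x = 0) (hP : P.map S = logNormal M V) (hV : 0 < V) :
    distFun P (fun ω => quantile F (distFun P S (S ω))) = F := by
  rw [distFun, map_quantile_distFun hS hF hneg hP hV]
  exact cdf_measure_stieltjesFunction F hF.1 hF.2

lemma memLp_quantile_distFun_exp (hF : IsDistributionFunction F)
    (hint : IntegrableOn (fun u => quantile F u ^ 2) (Ioo 0 1))
    (hP : P.map S = logNormal M V) (hV : 0 < V) :
    MemLp (fun y => quantile F (distFun P S (Real.exp y))) 2 (gaussianReal M V.toNNReal) := by
  have hv : V.toNNReal ≠ 0 := by simpa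
  simp only [distFun_exp hP]
  exact memLp_quantile_cdf hF hint (strictMono_cdf_gaussianReal M hv)
    (continuous_cdf_gaussianReal M hv)

lemma integrable_quantile_distFun (hS : Measurable S) (hF : IsDistributionFunction F)
    (hint : IntegrableOn (fun u => quantile F u ^ 2) (Ioo 0 1))
    (hP : P.map S = logNormal M V) (hV : 0 < V) :
    Integrable (fun ω => quantile F (distFun P S (S ω))) P :=
  (integrable_comp_iff_of_map_eq_logNormal hS hP
    (f := fun x => quantile F (distFun P S x))
    (monotone_quantile_distFun hF hP hV).measurable.aestronglyMeasurable).2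
    ((memLp_quantile_distFun_exp hF hint hP hV).integrable (by norm_num))

/-- Cauchy–Schwarz: the payoff and the exponential density of `Q` are both square integrable under
the Gaussian law. -/
lemma integrable_quantile_distFun_of_map_eq (hS : Measurable S) (hF : IsDistributionFunction F)
    (hint : IntegrableOn (fun u => quantile F u ^ 2) (Ioo 0 1))
    (hP : P.map S = logNormal M V) (hQ : Q.map S = logNormal M₀ V) (hV : 0 < V) :
    Integrable (fun ω => quantile F (distFun P S (S ω))) Q := by
  have hm := (monotone_quantile_distFun hF hP hV).measurable
  obtain ⟨C, hC⟩ := exists_lintegral_eq_lintegral_mul_exp_neg hS hQ M hV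
  have hprod := (memLp_quantile_distFun_exp hF hint hP hV).integrable_mul
    (memLp_exp_neg_affine_gaussianReal M V.toNNReal ((M - M₀) / V) C)
  refine (lintegral_ofReal_ne_top_iff_integrable (hm.comp hS).aestronglyMeasurable
    (ae_of_all _ fun ω => quantile_nonneg F _)).1 ?_
  have hE := hC (fun x => ENNReal.ofReal (quantile F (distFun P S x))) hm.ennreal_ofReal
  simp only [Function.comp_apply]
  rw [hE]
  refine ne_of_eq_of_ne ?_ hprod.lintegral_lt_top.ne
  refine lintegral_congr fun y => ?_
  rw [Pi.mul_apply, ENNReal.ofReal_mul (quantile_nonneg F _)]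

/-- A payoff whose law under `P` dominates `F` has truncated expectations above those of the
quantile payoff. -/
lemma integral_min_quantile_le [IsProbabilityMeasure P] (hS : Measurable S)
    (hF : IsDistributionFunction F) (hneg : ∀ x < 0, F x = 0) (hP : P.map S = logNormal M V)
    (hV : 0 < V) {Y : Ω → ℝ} (hY : AEMeasurable Y P) (hY0 : ∀ ω, 0 ≤ Y ω)
    (hord : IntegralOrder SSD F (distFun P Y)) {k : ℝ} (hk : 0 ≤ k) :
    ∫ ω, min (quantile F (distFun P S (S ω))) k ∂P ≤ ∫ ω, min (Y ω) k ∂P := by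
  have hX : AEMeasurable (fun ω => quantile F (distFun P S (S ω))) P :=
    ((monotone_quantile_distFun hF hP hV).measurable.comp hS).aemeasurable
  have hint : ∀ {Z : Ω → ℝ}, AEMeasurable Z P → (∀ ω, 0 ≤ Z ω) →
      Integrable (fun ω => min (Z ω) k) P := fun {Z} hZ hZ0 =>
    (integrable_const k).mono' (hZ.min aemeasurable_const).aestronglyMeasurable
      (ae_of_all _ fun ω => by
        rw [Real.norm_of_nonneg (le_min (hZ0 ω) hk)]; exact min_le_right _ _)
  -- `F` is realised as the distribution function of the quantile payoff, so that both sides become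
  -- expectations under `P`.
  rw [← distFun_quantile_distFun hS hF hneg hP hV, integralOrder_distFun_iff hX
    (ae_of_all _ fun ω => quantile_nonneg F _) hY (ae_of_all _ hY0)] at hord
  exact hord _ (min_const_mem_SSD k) (hint hX fun ω => quantile_nonneg F _) (hint hY hY0)

end Payoff

end RobustCost

/-! ### The robust cost-efficiency theorem. -/

open RobustCost in
theorem proposition3 {Ω : Type*} [mΩ : MeasurableSpace Ω]
    (S : Ω → ℝ) (hS : ∀ ω, 0 ≤ S ω)
    -- the σ-algebra on `Ω` is the one generated by `S`
    (hgen : mΩ = MeasurableSpace.comap S inferInstance)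
    (S₀ T r s μ₁ μ₂ σ₁ : ℝ) (hS₀ : 0 < S₀) (hT : 0 < T)
    (hμ : μ₁ < μ₂) (hσ₁ : 0 < σ₁) (hσ : σ₁ ≤ s)
    (Q : Measure Ω) [IsProbabilityMeasure Q] (hQ : Q.map S = RobustCost.priceLaw S₀ T r s)
    (P : ℝ → ℝ → Measure Ω)
    (hP : ∀ μ ∈ Set.Icc μ₁ μ₂, ∀ σ ∈ Set.Icc σ₁ s,
      IsProbabilityMeasure (P μ σ) ∧ (P μ σ).map S = RobustCost.priceLaw S₀ T μ σ)
    (hratio : (μ₁ - r) / s ^ 2 ∈ Set.Ioc (0 : ℝ) 1) :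
    -- the law of `S` under `P^{μ₁,s}` is dominated by every other plausible law
    (∀ μ ∈ Set.Icc μ₁ μ₂, ∀ σ ∈ Set.Icc σ₁ s,
      RobustCost.IntegralOrder RobustCost.SSD
        (RobustCost.distFun (P μ₁ s) S) (RobustCost.distFun (P μ σ) S)) ∧
    -- `P^{μ₁,s}` is the least favorable measure
    RobustCost.IsLeastFavorable RobustCost.SSD
      (RobustCost.plausible P μ₁ μ₂ σ₁ s) Q (P μ₁ s) ∧
    (∀ P' : Measure Ω, RobustCost.IsLeastFavorable RobustCost.SSD
      (RobustCost.plausible P μ₁ μ₂ σ₁ s) Q P' → P' = P μ₁ s) ∧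
    -- its likelihood ratio is continuously distributed, with an inverse of finite variance
    Continuous (RobustCost.distFun (P μ₁ s) (RobustCost.likelihoodRatio (P μ₁ s) Q)) ∧
    MemLp (fun ω => 1 / RobustCost.likelihoodRatio (P μ₁ s) Q ω) 2 (P μ₁ s) ∧
    -- the robust cost-efficient payoff
    ∀ F₀ : StieltjesFunction ℝ, RobustCost.IsDistributionFunction F₀ →
      (∀ x < 0, F₀ x = 0) →
      IntegrableOn (fun u => RobustCost.quantile F₀ u ^ 2) (Set.Ioo 0 1) →
      ConcaveOn ℝ (Set.Ici 0) (fun x => RobustCost.quantile F₀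
        (RobustCost.distFun (P μ₁ s) (RobustCost.likelihoodRatio (P μ₁ s) Q) x)) →
      RobustCost.IsRobustCostEfficient RobustCost.SSD (RobustCost.plausible P μ₁ μ₂ σ₁ s) S Q r T
        F₀ (fun ω => RobustCost.quantile F₀ (RobustCost.distFun (P μ₁ s) S (S ω))) ∧
      ∀ X : Ω → ℝ, RobustCost.IsRobustCostEfficient RobustCost.SSD
          (RobustCost.plausible P μ₁ μ₂ σ₁ s) S Q r T F₀ X →
        X =ᵐ[P μ₁ s] fun ω => RobustCost.quantile F₀ (RobustCost.distFun (P μ₁ s) S (S ω)) := by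
  have hSm : Measurable S := by rw [measurable_iff_comap_le]; exact hgen.ge
  have hs : 0 < s := hσ₁.trans_le hσ
  have hμ₁ : μ₁ ∈ Icc μ₁ μ₂ := ⟨le_rfl, hμ.le⟩
  have hsmem : s ∈ Icc σ₁ s := ⟨hσ, le_rfl⟩
  have hμr : 0 < μ₁ - r := by
    have := mul_pos hratio.1 (show 0 < s ^ 2 by positivity)
    rwa [div_mul_cancel₀ _ (by positivity)] at this
  unfold priceLaw at hP hQ
  obtain ⟨hprob, hlaw⟩ := hP μ₁ hμ₁ s hsmem
  set Ps := P μ₁ s with hPs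
  set M := Real.log S₀ + (μ₁ - s ^ 2 / 2) * T with hM
  set M₀ := Real.log S₀ + (r - s ^ 2 / 2) * T with hM₀
  set V := s ^ 2 * T with hVdef
  have hV : 0 < V := by positivity
  have hv : V.toNNReal ≠ 0 := by simpa
  have hMM : M₀ < M := by
    rw [hM, hM₀]; nlinarith [mul_pos hμr hT]
  set κ := (M - M₀) / V with hκdef
  have hκ : κ = (μ₁ - r) / s ^ 2 := by
    rw [hκdef, hM, hM₀, hVdef]
    field_simp
    ring
  have hκ0 : 0 < κ := hκ ▸ hratio.1
  have hκ1 : κ ≤ 1 := hκ ▸ hratio.2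
  -- The third clause compares the log-means `log S₀ + μ T` of the expectations, in which `σ`
  -- cancels; the fourth, used for uniqueness, compares the means of `log S`.
  have hparam : ∀ μ ∈ Icc μ₁ μ₂, ∀ σ ∈ Icc σ₁ s,
      0 < σ ^ 2 * T ∧ σ ^ 2 * T ≤ V ∧
      M + V / 2 ≤ Real.log S₀ + (μ - σ ^ 2 / 2) * T + σ ^ 2 * T / 2 ∧
      M ≤ Real.log S₀ + (μ - σ ^ 2 / 2) * T := by
    intro μ hμ' σ hσ'
    have hσ0 : 0 < σ := hσ₁.trans_le hσ'.1
    have h2 : σ ^ 2 ≤ s ^ 2 := pow_le_pow_left₀ hσ0.le hσ'.2 2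
    have h3 : σ ^ 2 * T ≤ s ^ 2 * T := mul_le_mul_of_nonneg_right h2 hT.le
    have h4 : μ₁ * T ≤ μ * T := mul_le_mul_of_nonneg_right hμ'.1 hT.le
    refine ⟨by positivity, h3, ?_, ?_⟩
    · rw [hM, hVdef]; linarith
    · rw [hM]; linarith
  obtain ⟨C, hC⟩ := exists_gaussianRatio_eq_exp_affine M M₀ hv
  rw [Real.coe_toNNReal _ hV.le] at hC
  set ℓ := likelihoodRatio Ps Q with hℓdef
  have hℓQ : ℓ =ᵐ[Q] fun ω => Real.exp (κ * Real.log (S ω) + C) := by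
    filter_upwards [likelihoodRatio_ae_eq hgen hlaw hQ hV hV] with ω hω
    rw [hℓdef, hω, hC]
  have hℓ : ∀ μ ∈ Icc μ₁ μ₂, ∀ σ ∈ Icc σ₁ s,
      ℓ =ᵐ[P μ σ] fun ω => Real.exp (κ * Real.log (S ω) + C) := fun μ hμ' σ hσ' =>
    (absolutelyContinuous_of_map_eq_logNormal hgen (hP μ hμ' σ hσ').2 hQ
      (hparam μ hμ' σ hσ').1 hV).ae_eq hℓQ
  have hℓs : ℓ =ᵐ[Ps] fun ω => Real.exp (κ * Real.log (S ω) + C) := hℓ μ₁ hμ₁ s hsmem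
  have hℓm : Measurable ℓ := (Measure.measurable_rnDeriv Ps Q).ennreal_toReal
  have hℓ0 : ∀ ω, 0 ≤ ℓ ω := fun _ => ENNReal.toReal_nonneg
  have hPsmem : Ps ∈ plausible P μ₁ μ₂ σ₁ s := ⟨μ₁, hμ₁, s, hsmem, rfl⟩
  have hlogm : Measurable fun ω => Real.log (S ω) := Real.measurable_log.comp hSm
  have hlog := map_log_of_map_eq_logNormal hSm hlaw
  have hψ := strictMono_exp_affine hκ0 C
  have hψm := hψ.monotone.measurable
  have hℓlaw : Ps.map ℓ = (gaussianReal M V.toNNReal).map fun y => Real.exp (κ * y + C) := by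
    rw [Measure.map_congr hℓs, ← hlog, Measure.map_map hψm hlogm]
    rfl
  -- comparison of nondecreasing concave functions of the likelihood ratio
  have hcmp : ∀ μ ∈ Icc μ₁ μ₂, ∀ σ ∈ Icc σ₁ s, ∀ f ∈ SSD,
      Integrable (fun ω => f (ℓ ω)) Ps → Integrable (fun ω => f (ℓ ω)) (P μ σ) →
        ∫ ω, f (ℓ ω) ∂Ps ≤ ∫ ω, f (ℓ ω) ∂(P μ σ) := by
    intro μ hμ' σ hσ' f hf hi hi'
    obtain ⟨h1, h2, h3, -⟩ := hparam μ hμ' σ hσ'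
    exact integral_comp_exp_log_le hSm hlaw (hP μ hμ' σ hσ').2 h1.le h2 h3 hκ0.le hκ1 hℓs
      (hℓ μ hμ' σ hσ') hf hi hi'
  refine ⟨?_, ⟨hPsmem, ?_⟩, ?_, ?_, ?_, ?_⟩
  · intro μ hμ' σ hσ'
    obtain ⟨hpr, hl⟩ := hP μ hμ' σ hσ'
    obtain ⟨h1, h2, h3, -⟩ := hparam μ hμ' σ hσ'
    rw [integralOrder_distFun_iff hSm.aemeasurable (ae_of_all _ hS) hSm.aemeasurable
      (ae_of_all _ hS)]
    exact fun f hf hi hi' =>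
      integral_comp_le_of_map_eq_logNormal hSm hlaw hl h1.le h2 h3 hf hi hi'
  · rintro _ ⟨μ, hμ', σ, hσ', rfl⟩
    have hpr := (hP μ hμ' σ hσ').1
    rw [integralOrder_distFun_iff hℓm.aemeasurable (ae_of_all _ hℓ0) hℓm.aemeasurable
      (ae_of_all _ hℓ0)]
    exact hcmp μ hμ' σ hσ'
  · rintro _ ⟨⟨μ, hμ', σ, hσ', rfl⟩, hfav⟩
    obtain ⟨hpr, hl⟩ := hP μ hμ' σ hσ'
    obtain ⟨h1, h2, -, h4⟩ := hparam μ hμ' σ hσ'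
    -- A competing least favorable measure need only be tested against `Ps`.
    obtain ⟨e1, e2⟩ := eq_of_integralOrder_likelihoodRatio hgen hlaw hl hQ h1 h2 hMM.le h4
      (hfav Ps hPsmem)
    refine ext_of_map_of_eq_comap hgen ?_
    rw [hl, hlaw, e1, e2]
  · have := Measure.isProbabilityMeasure_map hℓm.aemeasurable (μ := Ps)
    refine continuous_cdf_of_measure_singleton (ν := Ps.map ℓ) fun x => ?_
    have := nullSingletonClass_gaussianReal (μ := M) hv
    rw [hℓlaw, Measure.map_apply hψm (measurableSet_singleton x)]
    exact (subsingleton_singleton.preimage hψ.injective).measure_zero _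
  · have h := memLp_exp_neg_affine_gaussianReal M V.toNNReal κ C
    rw [← hlog] at h
    refine ((memLp_map_measure_iff h.1 hlogm.aemeasurable).1 h).ae_eq ?_
    filter_upwards [hℓs] with ω hω
    rw [hω, Function.comp_apply, Real.exp_neg, one_div]
  intro F₀ hF hneg hint hconc
  set H : ℝ → ℝ := fun x => quantile F₀ (distFun Ps S x) with hH
  have hHmono : Monotone H := monotone_quantile_distFun hF hlaw hV
  have hH0 : ∀ x, 0 ≤ H x := fun x => quantile_nonneg F₀ _
  have hXm : Measurable fun ω => H (S ω) := hHmono.measurable.comp hSm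
  have hHQ : Integrable (fun ω => H (S ω)) Q :=
    integrable_quantile_distFun_of_map_eq hSm hF hint hlaw hQ hV
  have hHP : Integrable (fun ω => H (S ω)) Ps := integrable_quantile_distFun hSm hF hint hlaw hV
  set φ : ℝ → ℝ := fun x => quantile F₀ (distFun Ps ℓ x) with hφ
  have hφ0 : ∀ x, 0 ≤ φ x := fun x => quantile_nonneg F₀ _
  have hφSSD : φ ∈ SSD := by
    refine ⟨(monotone_quantile_comp hF (distFun Ps ℓ).mono fun x => ?_).monotoneOn _, hconc⟩
    rw [distFun, hℓlaw]
    exact cdf_map_lt_one (strictMono_cdf_gaussianReal M hv) hψ (exists_le_exp_affine hκ0 C) x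
  -- `ℓ` and `S` are a.s. strictly increasing functions of `log S`, so their distribution functions
  -- under `Ps`, evaluated at themselves, both give the Gaussian one at `log S`.
  have hXφ : ∀ μ ∈ Icc μ₁ μ₂, ∀ σ ∈ Icc σ₁ s,
      (fun ω => H (S ω)) =ᵐ[P μ σ] fun ω => φ (ℓ ω) := by
    intro μ hμ' σ hσ'
    filter_upwards [hℓ μ hμ' σ hσ', ae_pos_of_map_eq_logNormal hSm (hP μ hμ' σ hσ').2]
      with ω hω hpos
    have h1 : distFun Ps ℓ (ℓ ω) = cdf (gaussianReal M V.toNNReal) (Real.log (S ω)) := by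
      rw [hω, distFun, hℓlaw]
      exact cdf_map_apply_of_strictMono hψ _
    have h2 : distFun Ps S (S ω) = cdf (gaussianReal M V.toNNReal) (Real.log (S ω)) := by
      rw [← distFun_exp hlaw, Real.exp_log hpos]
    simp only [hH, hφ, h1, h2]
  have hadm : (fun ω => H (S ω)) ∈ admissible SSD (plausible P μ₁ μ₂ σ₁ s) S Q F₀ := by
    refine ⟨⟨H, hHmono.measurable, fun x _ => hH0 x, rfl, hHQ⟩, ?_⟩
    rintro _ ⟨μ, hμ', σ, hσ', rfl⟩
    have hpr := (hP μ hμ' σ hσ').1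
    have hae := hXφ μ hμ' σ hσ'
    have haes : (fun ω => H (S ω)) =ᵐ[Ps] fun ω => φ (ℓ ω) := hXφ μ₁ hμ₁ s hsmem
    have hiff := integralOrder_distFun_iff (P := Ps) (P' := P μ σ) hXm.aemeasurable
      (ae_of_all _ fun ω => hH0 (S ω)) hXm.aemeasurable (ae_of_all _ fun ω => hH0 (S ω))
    rw [hH, distFun_quantile_distFun hSm hF hneg hlaw hV] at hiff
    refine hiff.2 fun f hf hi hi' => ?_
    have e : (fun ω => f (H (S ω))) =ᵐ[P μ σ] fun ω => f (φ (ℓ ω)) := hae.fun_comp f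
    have es : (fun ω => f (H (S ω))) =ᵐ[Ps] fun ω => f (φ (ℓ ω)) := haes.fun_comp f
    -- Least favorability is applied to the test function `f ∘ φ`, where the concavity of `φ`
    -- enters.
    exact (integral_congr_ae es).trans_le ((hcmp μ hμ' σ hσ' _
      (comp_mem_SSD hf hφSSD fun x _ => hφ0 x) (hi.congr es) (hi'.congr e)).trans_eq
      (integral_congr_ae e).symm)
  have hmin : ∀ g : ℝ → ℝ, Measurable g → (∀ x, 0 ≤ x → 0 ≤ g x) →
      IntegralOrder SSD F₀ (distFun Ps fun ω => g (S ω)) →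
      ∀ k, 0 ≤ k → ∫ ω, min (H (S ω)) k ∂Ps ≤ ∫ ω, min (g (S ω)) k ∂Ps :=
    fun g hg hg0 hord k hk => integral_min_quantile_le hSm hF hneg hlaw hV
      (hg.comp hSm).aemeasurable (fun ω => hg0 _ (hS ω)) hord hk
  have hdisc : 0 < Real.exp (-(r * T)) := Real.exp_pos _
  refine ⟨⟨hadm, ?_⟩, ?_⟩
  · rintro _ ⟨⟨g, hg, hg0, rfl, hgi⟩, hdom⟩
    -- Of the competitor's constraints only the one under `Ps` is needed.
    exact mul_le_mul_of_nonneg_left (integral_le_of_integral_min_le hSm hS hlaw hQ hV hMM hHmono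
      hH0 hg hg0 hgi (hmin g hg hg0 (hdom Ps hPsmem))) hdisc.le
  · rintro _ ⟨⟨⟨g, hg, hg0, rfl, hgi⟩, hdom⟩, hopt⟩
    exact ae_eq_of_integral_le_of_integral_min_le hSm hS hlaw hQ hV hMM hHmono hH0 hg hg0 hHP
      hHQ hgi (hmin g hg hg0 (hdom Ps hPsmem)) (le_of_mul_le_mul_left (hopt _ hadm) hdisc)
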